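/- Let $(X,d)$ be a complete and separable metric space and let $m\ge 0$ be a Borel measure on $X$ that is finite on $d$-bounded sets. Let $(d_i)_{i\in\mathbb N}$ be complete distances on $X$, each inducing the same topology as $d$, such that for all $x,y\in X$ the sequence $d_i(x,y)$ is non-decreasing in $i$ and converges to $d(x,y)$. Let $p\in(1,\infty)$. For $\delta\in\{d\}\cup\{d_i : i\in\mathbb N\}$ and a $\delta$-Lipschitz function $f\colon X\to\mathbb R$, let $$\mathrm{lip}_a^{\delta}(f)(x)=\inf_{r>0}\ \sup\Big\{\tfrac{|f(y)-f(z)|}{\delta(y,z)} : y\ne z,\ \delta(x,y)<r,\ \delta(x,z)<r\Big\}\qquad(\sup\emptyset=0)$$ be its asymptotic slope. For $f\in L^p(m)$ let $\mathcal E_{a,p}^{\delta}(f)=\frac1p\int \mathrm{lip}_a^{\delta}(f)^p\,dm$ if $f$ is (represented by) a $\delta$-Lipschitz function with $\delta$-bounded support, and $\mathcal E_{a,p}^{\delta}(f)=+\infty$ otherwise (if a class in $L^p(m)$ has several such representatives, the infimum over them is taken). The Cheeger $p$-energy $\mathcal E_{\mathrm{Ch},p}^{\delta}\colon L^p(m)\to[0,+\infty]$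 is the relaxation $$\mathcal E_{\mathrm{Ch},p}^{\delta}(f)=\inf\Big\{\liminf_{n\to\infty}\mathcal E_{a,p}^{\delta}(f_n)\ :\ (f_n)_n\subseteq L^p(m),\ f_n\to f \text{ strongly in } L^p(m)\Big\}.$$ Then $\mathcal E_{\mathrm{Ch},p}^{d_i}$ Mosco-converges to $\mathcal E_{\mathrm{Ch},p}^{d}$ as $i\to\infty$, that is: (i) (weak $\Gamma$-liminf) if $(f_i)_i\subseteq L^p(m)$ converges weakly in $L^p(m)$ to $f\in L^p(m)$, then $\mathcal E_{\mathrm{Ch},p}^{d}(f)\le\liminf_{i\to\infty}\mathcal E_{\mathrm{Ch},p}^{d_i}(f_i)$; (ii) (strong $\Gamma$-limsup) for every $f\in L^p(m)$ there is a sequence $(f_i)_i\subseteq L^p(m)$ converging strongly to $f$ in $L^p(m)$ with $\mathcal E_{\mathrm{Ch},p}^{d}(f)\ge\limsup_{i\to\infty}\mathcal E_{\mathrm{Ch},p}^{d_i}(f_i)$. -/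

import Mathlib

open MeasureTheory Filter Topology
open scoped ENNReal

noncomputable section

/-- The Lipschitz constant of `f` on the set `E`, with values in `[0,∞]`.  Pairs `x = y` contribute
`0 / 0 = 0`, so the constant of the empty set and of a singleton is `0`. -/
def lipConst {X : Type*} [MetricSpace X] (f : X → ℝ) (E : Set X) : ℝ≥0∞ :=
  ⨆ x ∈ E, ⨆ y ∈ E, edist (f x) (f y) / edist x y

/-- The asymptotic slope `lip_a(f)(x) = inf_{r > 0} Lip(f; B_r(x))`. -/
def asymptoticSlope {X : Type*} [MetricSpace X] (f : X → ℝ) (x : X) : ℝ≥0∞ :=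
  ⨅ (r : ℝ) (_ : 0 < r), lipConst f (Metric.ball x r)

/-- The asymptotic `p`-energy on `L^p(m)` with respect to the distance `D`:
`(1/p) ∫ lip_a(f)^p dm` if `f` is (represented by) a boundedly-supported `D`-Lipschitz function, and
`∞` (the infimum of the empty set) otherwise.  Elements of `L^p(m)` are classes modulo `m`-null sets;
if a class has several Lipschitz representatives, the infimum over them is taken. -/
def asymptoticEnergy {X : Type*} [MeasurableSpace X] (D : MetricSpace X) (m : Measure X)
    (p : ℝ≥0∞) (f : Lp ℝ p m) : ℝ≥0∞ :=
  ⨅ (g : X → ℝ) (_ : (∃ K, LipschitzWith K g) ∧ Bornology.IsBounded (tsupport g) ∧ f =ᵐ[m] g),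
    ENNReal.ofReal (1 / p.toReal) * ∫⁻ x, asymptoticSlope g x ^ p.toReal ∂m

/-- The Cheeger `p`-energy with respect to the distance `D`: the `L^p(m)`-lower semicontinuous
relaxation of the asymptotic `p`-energy. -/
def cheegerEnergy {X : Type*} [MeasurableSpace X] (D : MetricSpace X) (m : Measure X)
    (p : ℝ≥0∞) [Fact (1 ≤ p)] (f : Lp ℝ p m) : ℝ≥0∞ :=
  ⨅ (g : ℕ → Lp ℝ p m) (_ : Tendsto g atTop (𝓝 f)),
    liminf (fun n => asymptoticEnergy D m p (g n)) atTop

/-- Weak convergence of a sequence in a normed space. -/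
def WeaklyConverges {E : Type*} [NormedAddCommGroup E] [NormedSpace ℝ E] (u : ℕ → E) (v : E) :
    Prop :=
  ∀ φ : E →L[ℝ] ℝ, Tendsto (fun i => φ (u i)) atTop (𝓝 (φ v))

/-- Mosco-convergence of functionals on a normed space: the weak `Γ`-liminf inequality, and the
existence of strong recovery sequences. -/
def MoscoConverges {E : Type*} [NormedAddCommGroup E] [NormedSpace ℝ E]
    (F : ℕ → E → ℝ≥0∞) (G : E → ℝ≥0∞) : Prop :=
  (∀ (f : E) (u : ℕ → E), WeaklyConverges u f → G f ≤ liminf (fun i => F i (u i)) atTop) ∧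
  (∀ f : E, ∃ u : ℕ → E, Tendsto u atTop (𝓝 f) ∧ limsup (fun i => F i (u i)) atTop ≤ G f)

end

/-! Liminf. Since `d i ≤ D`, passing from `d i` to `D` shrinks balls and enlarges denominators, so
slopes decrease and `d i`-Lipschitz functions stay `D`-Lipschitz. Their supports may be
`D`-unbounded; cutoffs repair this (`cheegerEnergy_le_of_lipschitz`), so the `D`-energy lies below
every `d i`-energy. Being convex and strongly lower semicontinuous, the `D`-energy is weakly lower
semicontinuous by Hahn–Banach.

Limsup. It suffices to approximate a `D`-Lipschitz `g` with bounded support by `d i`-Lipschitz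
functions with almost the same slope integral (`exists_lipschitz_approx`). For `g ≥ 0`, minimise
over discrete paths from `x`, with `d i`-steps at most `s`, the value of `g` at the end plus the sum
of the steps weighted by `W`. Here `W` dominates the Lipschitz constant of `g` on `D`-balls of
radius `r`. The infimum is `d i`-Lipschitz, has slope at most the local bound of `W`, and is at most
`g`.

It is also at least `g` minus a small error, provided `D` and `d i` nearly agree along the relevant
paths. A Dini argument gives this agreement near compact sets (`exists_forall_dist_le_add`). Hence
`W` is also made large on the part of the support far from compact sets `K j` carrying almost all
the measure: cheap paths cannot stray from them, and by tightness the extra weight is small in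
`L^p`. A signed `g` is split into positive and negative parts, truncated so that their slopes do not
add. -/

section Slope

/-! ### Lipschitz constants on balls and the asymptotic slope. -/

variable {X : Type*} [MetricSpace X]

theorem lipConst_le_iff {f : X → ℝ} {E : Set X} {K : ℝ≥0∞} :
    lipConst f E ≤ K ↔ ∀ x ∈ E, ∀ y ∈ E, edist (f x) (f y) ≤ K * edist x y := by
  simp only [lipConst, iSup_le_iff]
  refine forall₂_congr fun x _ => forall₂_congr fun y _ => ?_
  rcases eq_or_ne x y with rfl | h
  · simp
  · exact ENNReal.div_le_iff_le_mul (Or.inl (by simpa using h)) (Or.inl (edist_ne_top x y))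

theorem lipConst_mono {f : X → ℝ} {E F : Set X} (h : E ⊆ F) : lipConst f E ≤ lipConst f F :=
  lipConst_le_iff.2 fun x hx y hy => lipConst_le_iff.1 le_rfl x (h hx) y (h hy)

theorem asymptoticSlope_le_lipConst {f : X → ℝ} {x : X} {r : ℝ} (hr : 0 < r) :
    asymptoticSlope f x ≤ lipConst f (Metric.ball x r) :=
  iInf₂_le r hr

theorem asymptoticSlope_lt_iff {f : X → ℝ} {x : X} {K : ℝ≥0∞} :
    asymptoticSlope f x < K ↔ ∃ r : ℝ, 0 < r ∧ lipConst f (Metric.ball x r) < K := by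
  simp [asymptoticSlope, iInf_lt_iff]

theorem upperSemicontinuous_asymptoticSlope (f : X → ℝ) :
    UpperSemicontinuous (asymptoticSlope f) := by
  intro x K hK
  obtain ⟨r, hr, h⟩ := asymptoticSlope_lt_iff.1 hK
  filter_upwards [Metric.ball_mem_nhds x (half_pos hr)] with y hy
  refine asymptoticSlope_lt_iff.2 ⟨r / 2, half_pos hr, lt_of_le_of_lt (lipConst_mono ?_) h⟩
  refine Metric.ball_subset_ball' ?_
  rw [Metric.mem_ball] at hy
  linarith

theorem measurable_asymptoticSlope [MeasurableSpace X] [OpensMeasurableSpace X] (f : X → ℝ) :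
    Measurable (asymptoticSlope f) :=
  (upperSemicontinuous_asymptoticSlope f).measurable

/-- Balls are open, so a pair of points witnessing a large quotient stays in the ball when the
centre moves slightly. -/
theorem lowerSemicontinuous_lipConst_ball (f : X → ℝ) (r : ℝ) :
    LowerSemicontinuous fun x => lipConst f (Metric.ball x r) := by
  intro x K hK
  simp only [lipConst, lt_iSup_iff] at hK
  obtain ⟨y, hy, z, hz, h⟩ := hK
  rw [Metric.mem_ball, dist_comm] at hy hz
  have hcont : ∀ w : X, Continuous fun x' : X => dist x' w := fun w => by fun_prop
  filter_upwards [(hcont y).continuousAt.eventually_lt_const hy,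
    (hcont z).continuousAt.eventually_lt_const hz] with x' hy' hz'
  simp only [lipConst, lt_iSup_iff]
  exact ⟨y, by rwa [Metric.mem_ball, dist_comm], z, by rwa [Metric.mem_ball, dist_comm], h⟩

theorem measurable_lipConst_ball [MeasurableSpace X] [OpensMeasurableSpace X]
    (f : X → ℝ) (r : ℝ) : Measurable fun x => lipConst f (Metric.ball x r) :=
  (lowerSemicontinuous_lipConst_ball f r).measurable

theorem LipschitzWith.lipConst_le {f : X → ℝ} {K : NNReal} (hf : LipschitzWith K f) (E : Set X) :
    lipConst f E ≤ K :=
  lipConst_le_iff.2 fun x _ y _ => hf x y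

theorem tendsto_lipConst_ball (f : X → ℝ) (x : X) :
    Tendsto (fun n : ℕ => lipConst f (Metric.ball x (1 / ((n : ℝ) + 1)))) atTop
      (𝓝 (asymptoticSlope f x)) := by
  refine tendsto_order.2 ⟨fun a ha => ?_, fun a ha => ?_⟩
  · exact Eventually.of_forall fun n =>
      ha.trans_le (asymptoticSlope_le_lipConst (by positivity))
  · obtain ⟨r, hr, h⟩ := asymptoticSlope_lt_iff.1 ha
    filter_upwards [tendsto_one_div_add_atTop_nhds_zero_nat.eventually_lt_const hr] with n hn
    exact (lipConst_mono (Metric.ball_subset_ball hn.le)).trans_lt h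

theorem asymptoticSlope_add_smul_le (f g : X → ℝ) (a b : NNReal) (x : X) :
    asymptoticSlope (fun y => a * f y + b * g y) x
      ≤ a * asymptoticSlope f x + b * asymptoticSlope g x := by
  have key : ∀ n : ℕ, asymptoticSlope (fun y => a * f y + b * g y) x
      ≤ a * lipConst f (Metric.ball x (1 / ((n : ℝ) + 1)))
        + b * lipConst g (Metric.ball x (1 / ((n : ℝ) + 1))) := by
    intro n
    refine (asymptoticSlope_le_lipConst (r := 1 / ((n : ℝ) + 1)) (by positivity)).trans
      (lipConst_le_iff.2 fun y hy z hz => ?_)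
    have h1 := lipConst_le_iff.1 (le_refl (lipConst f (Metric.ball x (1 / ((n : ℝ) + 1))))) y hy z hz
    have h2 := lipConst_le_iff.1 (le_refl (lipConst g (Metric.ball x (1 / ((n : ℝ) + 1))))) y hy z hz
    have hs : ∀ (c : NNReal) (u v : ℝ), edist (c * u) (c * v) = c * edist u v := by
      intro c u v
      rw [edist_eq_enorm_sub, edist_eq_enorm_sub, ← mul_sub, enorm_mul]
      simp [enorm_eq_nnnorm]
    calc edist (a * f y + b * g y) (a * f z + b * g z)
        ≤ edist (a * f y) (a * f z) + edist (b * g y) (b * g z) := edist_add_add_le _ _ _ _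
      _ ≤ _ := by
        rw [hs, hs, add_mul, mul_assoc, mul_assoc]
        gcongr
  exact ge_of_tendsto' ((ENNReal.Tendsto.const_mul (tendsto_lipConst_ball f x)
    (Or.inr ENNReal.coe_ne_top)).add (ENNReal.Tendsto.const_mul (tendsto_lipConst_ball g x)
    (Or.inr ENNReal.coe_ne_top))) key

/-- Leibniz rule on small balls; replacing `f z` by `f x` costs `K` times the radius, which vanishes
in the limit. -/
theorem asymptoticSlope_mul_le {f η : X → ℝ} {K c : NNReal} (hf : LipschitzWith K f)
    (hη : LipschitzWith c η) (hη1 : ∀ y, ‖η y‖ₑ ≤ 1) (x : X) :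
    asymptoticSlope (fun y => f y * η y) x ≤ asymptoticSlope f x + c * ‖f x‖ₑ := by
  have key : ∀ n : ℕ, asymptoticSlope (fun y => f y * η y) x
      ≤ lipConst f (Metric.ball x (1 / ((n : ℝ) + 1)))
        + c * (‖f x‖ₑ + K * ENNReal.ofReal (1 / ((n : ℝ) + 1))) := by
    intro n
    refine (asymptoticSlope_le_lipConst (r := 1 / ((n : ℝ) + 1)) (by positivity)).trans
      (lipConst_le_iff.2 fun y hy z hz => ?_)
    have h1 := lipConst_le_iff.1 (le_refl (lipConst f (Metric.ball x (1 / ((n : ℝ) + 1))))) y hy z hz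
    have h2 := hη y z
    have h3 : ‖f z‖ₑ ≤ ‖f x‖ₑ + K * ENNReal.ofReal (1 / ((n : ℝ) + 1)) := by
      calc ‖f z‖ₑ = ‖f x + (f z - f x)‖ₑ := by congr 1; ring
        _ ≤ ‖f x‖ₑ + ‖f z - f x‖ₑ := enorm_add_le _ _
        _ = ‖f x‖ₑ + edist (f z) (f x) := by rw [edist_eq_enorm_sub]
        _ ≤ ‖f x‖ₑ + K * edist z x := by gcongr; exact hf z x
        _ ≤ _ := by
          gcongr
          rw [edist_dist]
          exact ENNReal.ofReal_le_ofReal (Metric.mem_ball.1 hz).le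
    calc edist (f y * η y) (f z * η z)
        = ‖η y * (f y - f z) + f z * (η y - η z)‖ₑ := by
          rw [edist_eq_enorm_sub]; congr 1; ring
      _ ≤ ‖η y‖ₑ * edist (f y) (f z) + ‖f z‖ₑ * edist (η y) (η z) := by
          rw [edist_eq_enorm_sub, edist_eq_enorm_sub, ← enorm_mul, ← enorm_mul]
          exact enorm_add_le _ _
      _ ≤ 1 * (lipConst f (Metric.ball x (1 / ((n : ℝ) + 1))) * edist y z)
          + (‖f x‖ₑ + K * ENNReal.ofReal (1 / ((n : ℝ) + 1))) * (c * edist y z) := by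
          gcongr
          exact hη1 y
      _ = _ := by ring
  have hlim : Tendsto (fun n : ℕ => ENNReal.ofReal (1 / ((n : ℝ) + 1))) atTop (𝓝 0) := by
    simpa using ENNReal.tendsto_ofReal tendsto_one_div_add_atTop_nhds_zero_nat
  have h4 : Tendsto (fun n : ℕ => ‖f x‖ₑ + K * ENNReal.ofReal (1 / ((n : ℝ) + 1))) atTop
      (𝓝 (‖f x‖ₑ + K * 0)) :=
    tendsto_const_nhds.add (ENNReal.Tendsto.const_mul hlim (Or.inr ENNReal.coe_ne_top))
  rw [mul_zero, add_zero] at h4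
  exact ge_of_tendsto' ((tendsto_lipConst_ball f x).add
    (ENNReal.Tendsto.const_mul h4 (Or.inr ENNReal.coe_ne_top))) key

end Slope

/-! ### Change of distance, products and cutoffs. -/

theorem asymptoticSlope_le_of_dist_le {X : Type*} (D' : MetricSpace X) [D : MetricSpace X]
    (h : ∀ x y : X, D'.dist x y ≤ D.dist x y) (f : X → ℝ) (x : X) :
    asymptoticSlope f x ≤ @asymptoticSlope X D' f x := by
  refine le_of_forall_gt fun K hK => ?_
  obtain ⟨r, hr, h'⟩ := (@asymptoticSlope_lt_iff X D' f x K).1 hK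
  refine asymptoticSlope_lt_iff.2 ⟨r, hr, lt_of_le_of_lt (lipConst_le_iff.2 fun y hy z hz => ?_) h'⟩
  refine ((@lipConst_le_iff X D' f (@Metric.ball X D'.toPseudoMetricSpace x r) _).1
    le_rfl y ((h y x).trans_lt hy) z ((h z x).trans_lt hz)).trans ?_
  gcongr
  rw [@edist_dist X D.toPseudoMetricSpace y z, @edist_dist X D'.toPseudoMetricSpace y z]
  exact ENNReal.ofReal_le_ofReal (h y z)

theorem LipschitzWith.exists_norm_le_of_isBounded_tsupport {X : Type*} [MetricSpace X]
    {g : X → ℝ} {K : NNReal} (hg : LipschitzWith K g) (hb : Bornology.IsBounded (tsupport g)) :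
    ∃ C : NNReal, ∀ x, ‖g x‖ ≤ C := by
  obtain ⟨C, hC⟩ := (hg.isBounded_image hb).exists_norm_le
  refine ⟨C.toNNReal, fun x => ?_⟩
  by_cases hx : g x = 0
  · simp [hx]
  · exact (hC _ ⟨x, subset_tsupport g hx, rfl⟩).trans (Real.le_coe_toNNReal C)

theorem lipschitzWith_mul_of_norm_le {X : Type*} [MetricSpace X] {f η : X → ℝ}
    {K c C : NNReal} (hf : LipschitzWith K f) (hη : LipschitzWith c η) (hC : ∀ x, ‖f x‖ ≤ C)
    (hη1 : ∀ x, ‖η x‖ ≤ 1) : LipschitzWith (K + C * c) fun x => f x * η x := by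
  refine LipschitzWith.of_dist_le_mul fun x y => ?_
  have h1 := hf.dist_le_mul x y
  have h2 := hη.dist_le_mul x y
  rw [Real.dist_eq] at h1 h2 ⊢
  calc |f x * η x - f y * η y| = |(f x - f y) * η x + f y * (η x - η y)| := by congr 1; ring
    _ ≤ |f x - f y| * |η x| + |f y| * |η x - η y| := by
      rw [← abs_mul, ← abs_mul]; exact abs_add_le _ _
    _ ≤ (K * dist x y) * 1 + C * (c * dist x y) := by
      gcongr
      · exact hη1 x
      · exact hC y
    _ = _ := by push_cast; ring

theorem lipschitzWith_of_dist_le {X : Type*} (D' : MetricSpace X) [D : MetricSpace X]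
    (h : ∀ x y : X, D'.dist x y ≤ D.dist x y) {f : X → ℝ} {K : NNReal}
    (hf : @LipschitzWith X ℝ D'.toPseudoMetricSpace.toPseudoEMetricSpace _ K f) :
    LipschitzWith K f := by
  refine LipschitzWith.of_dist_le_mul fun x y => ?_
  exact (@LipschitzWith.dist_le_mul X ℝ D'.toPseudoMetricSpace _ K f hf x y).trans
    (mul_le_mul_of_nonneg_left (h x y) K.2)

/-- A Lipschitz cutoff function equal to `1` on the ball of radius `n + 1` around `x₀` and
supported in the ball of radius `2 (n + 1)`. -/
noncomputable def ballCutoff {X : Type*} [MetricSpace X] (x₀ : X) (n : ℕ) (x : X) : ℝ :=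
  max 0 (min 1 (2 - dist x x₀ / (n + 1)))

section BallCutoff

variable {X : Type*} [MetricSpace X] (x₀ : X) (n : ℕ)

theorem lipschitzWith_ballCutoff : LipschitzWith ((n : NNReal) + 1)⁻¹ (ballCutoff x₀ n) := by
  refine LipschitzWith.const_max (LipschitzWith.const_min ?_ 1) 0
  refine LipschitzWith.of_dist_le_mul fun x y => ?_
  have : (2 - dist x x₀ / ((n : ℝ) + 1)) - (2 - dist y x₀ / (n + 1))
      = ((n : ℝ) + 1)⁻¹ * (dist y x₀ - dist x x₀) := by ring
  rw [Real.dist_eq, this, abs_mul, abs_of_pos (by positivity : (0 : ℝ) < ((n : ℝ) + 1)⁻¹)]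
  push_cast
  gcongr
  rw [dist_comm x y]
  exact abs_dist_sub_le y x x₀

theorem ballCutoff_nonneg (x : X) : 0 ≤ ballCutoff x₀ n x := le_max_left _ _

theorem ballCutoff_le_one (x : X) : ballCutoff x₀ n x ≤ 1 :=
  max_le zero_le_one (min_le_left _ _)

theorem norm_ballCutoff_le_one (x : X) : ‖ballCutoff x₀ n x‖ ≤ 1 := by
  rw [Real.norm_of_nonneg (ballCutoff_nonneg x₀ n x)]
  exact ballCutoff_le_one x₀ n x

theorem ballCutoff_eq_zero {x : X} (h : 2 * ((n : ℝ) + 1) < dist x x₀) : ballCutoff x₀ n x = 0 := by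
  refine max_eq_left ((min_le_right _ _).trans ?_)
  rw [sub_nonpos, le_div_iff₀ (by positivity)]
  exact h.le

theorem ballCutoff_eq_one {x : X} (h : dist x x₀ ≤ (n : ℝ) + 1) : ballCutoff x₀ n x = 1 := by
  have : (1 : ℝ) ≤ 2 - dist x x₀ / (n + 1) := by
    have : dist x x₀ / ((n : ℝ) + 1) ≤ 1 := (div_le_one (by positivity)).2 h
    linarith
  rw [ballCutoff, min_eq_left this]
  exact max_eq_right zero_le_one

theorem eventually_ballCutoff_eq_one (x : X) : ∀ᶠ n : ℕ in atTop, ballCutoff x₀ n x = 1 := by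
  obtain ⟨N, hN⟩ := exists_nat_ge (dist x x₀)
  filter_upwards [eventually_ge_atTop N] with n hn
  refine ballCutoff_eq_one x₀ n ?_
  have : (N : ℝ) ≤ n := by exact_mod_cast hn
  linarith

theorem isBounded_tsupport_mul_ballCutoff (g : X → ℝ) :
    Bornology.IsBounded (tsupport fun x => g x * ballCutoff x₀ n x) := by
  refine (Metric.isBounded_closedBall (x := x₀) (r := 2 * ((n : ℝ) + 1))).subset
    (closure_minimal (fun x hx => ?_) Metric.isClosed_closedBall)
  by_contra h
  rw [Metric.mem_closedBall, not_le] at h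
  exact hx (by simp [ballCutoff_eq_zero x₀ n h])

end BallCutoff

theorem tendsto_add_inv_natCast_add_one (a : ℝ≥0∞) :
    Tendsto (fun n : ℕ => a + ((n : ℝ≥0∞) + 1)⁻¹) atTop (𝓝 a) := by
  have h1 : Tendsto (fun n : ℕ => (((n + 1 : ℕ) : ℝ≥0∞))⁻¹) atTop (𝓝 0) :=
    ENNReal.tendsto_inv_nat_nhds_zero.comp (tendsto_add_atTop_nat 1)
  simpa using tendsto_const_nhds.add h1

/-! ### The Cheeger energy: convexity, weak lower semicontinuity, monotonicity in the distance. -/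

section Energy

variable {X : Type*} [MeasurableSpace X] {m : Measure X} {p : ℝ≥0∞}

theorem asymptoticEnergy_lt_iff (D : MetricSpace X) {f : Lp ℝ p m} {c : ℝ≥0∞} :
    asymptoticEnergy D m p f < c ↔ ∃ g : X → ℝ,
      ((∃ K, LipschitzWith K g) ∧ Bornology.IsBounded (tsupport g) ∧ f =ᵐ[m] g) ∧
      ENNReal.ofReal (1 / p.toReal) * ∫⁻ x, asymptoticSlope g x ^ p.toReal ∂m < c := by
  simp only [asymptoticEnergy, iInf_lt_iff, exists_prop]

variable [Fact (1 ≤ p)]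

/-- Trades the sequences of the relaxation for a single competitor with tolerances, so that diagonal
arguments become triangle inequalities. -/
theorem cheegerEnergy_le_iff (D : MetricSpace X) {f : Lp ℝ p m} {c : ℝ≥0∞} :
    cheegerEnergy D m p f ≤ c ↔ ∀ ε : ℝ≥0∞, ε ≠ 0 → ∀ δ : ℝ, 0 < δ → ∃ h : Lp ℝ p m,
      dist h f < δ ∧ asymptoticEnergy D m p h ≤ c + ε := by
  constructor
  · intro h ε hε δ hδ
    by_cases hc : c = ∞
    · exact ⟨f, by simpa using hδ, by simp [hc]⟩
    have hlt : cheegerEnergy D m p f < c + ε := h.trans_lt (ENNReal.lt_add_right hc hε)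
    simp only [cheegerEnergy, iInf_lt_iff] at hlt
    obtain ⟨u, hu, hlt⟩ := hlt
    have h1 := frequently_lt_of_liminf_lt (by isBoundedDefault) hlt
    obtain ⟨n, hn, hn'⟩ := (h1.and_eventually (Metric.tendsto_nhds.1 hu δ hδ)).exists
    exact ⟨u n, hn', hn.le⟩
  · intro h
    choose u hu hu' using fun n : ℕ => h ((n : ℝ≥0∞) + 1)⁻¹ (by simp) (1 / ((n : ℝ) + 1))
      (by positivity)
    refine (iInf₂_le u ?_).trans ((liminf_le_liminf (Eventually.of_forall hu')).trans
      (tendsto_add_inv_natCast_add_one c).liminf_eq.le)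
    rw [tendsto_iff_dist_tendsto_zero]
    exact squeeze_zero (fun _ => dist_nonneg) (fun n => (hu n).le)
      tendsto_one_div_add_atTop_nhds_zero_nat

theorem cheegerEnergy_le_asymptoticEnergy (D : MetricSpace X) (f : Lp ℝ p m) :
    cheegerEnergy D m p f ≤ asymptoticEnergy D m p f :=
  (cheegerEnergy_le_iff D).2 fun _ _ _ hδ => ⟨f, by simpa using hδ, le_self_add⟩

theorem cheegerEnergy_le_of_approx (D : MetricSpace X) {f : Lp ℝ p m} {c : ℝ≥0∞}
    (h : ∀ ε : ℝ≥0∞, ε ≠ 0 → ∀ δ : ℝ, 0 < δ → ∃ h : Lp ℝ p m,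
      dist h f < δ ∧ cheegerEnergy D m p h ≤ c + ε) : cheegerEnergy D m p f ≤ c := by
  refine (cheegerEnergy_le_iff D).2 fun ε hε δ hδ => ?_
  have hε2 : ε / 2 ≠ 0 := by simpa using hε
  obtain ⟨u, hu, hu'⟩ := h (ε / 2) hε2 (δ / 2) (half_pos hδ)
  obtain ⟨v, hv, hv'⟩ := (cheegerEnergy_le_iff D).1 hu' (ε / 2) hε2 (δ / 2) (half_pos hδ)
  refine ⟨v, (dist_triangle v u f).trans_lt (by linarith), hv'.trans ?_⟩
  rw [add_assoc, ENNReal.add_halves]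

theorem isClosed_setOf_cheegerEnergy_le (D : MetricSpace X) (c : ℝ≥0∞) :
    IsClosed {f : Lp ℝ p m | cheegerEnergy D m p f ≤ c} := by
  refine isClosed_of_closure_subset fun f hf => ?_
  refine cheegerEnergy_le_of_approx D fun ε _ δ hδ => ?_
  obtain ⟨h, hh, hd⟩ := Metric.mem_closure_iff.1 hf δ hδ
  exact ⟨h, by rwa [dist_comm], hh.trans le_self_add⟩

/-- Subadditivity of the slope and convexity of the `p`-th power. The strict bounds allow actual
Lipschitz representatives to be picked. -/
theorem asymptoticEnergy_convexComb_le (D : MetricSpace X) [OpensMeasurableSpace X]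
    (hp : p ≠ ∞) {f g : Lp ℝ p m} {c : ℝ≥0∞} {a b : NNReal} (hab : a + b = 1)
    (hf : asymptoticEnergy D m p f < c) (hg : asymptoticEnergy D m p g < c) :
    asymptoticEnergy D m p ((a : ℝ) • f + (b : ℝ) • g) ≤ c := by
  have hq1 : 1 ≤ p.toReal := by
    rw [← ENNReal.toReal_one]
    exact ENNReal.toReal_mono hp Fact.out
  obtain ⟨u, ⟨⟨K, hK⟩, hub, hfu⟩, hu⟩ := (asymptoticEnergy_lt_iff D).1 hf
  obtain ⟨v, ⟨⟨L, hL⟩, hvb, hgv⟩, hv⟩ := (asymptoticEnergy_lt_iff D).1 hg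
  have huv : LipschitzWith (a * K + b * L) fun x => a * u x + b * v x := by
    refine LipschitzWith.of_dist_le_mul fun x y => ?_
    have h1 := hK.dist_le_mul x y
    have h2 := hL.dist_le_mul x y
    calc dist (a * u x + b * v x) (a * u y + b * v y)
        ≤ dist (a * u x) (a * u y) + dist (b * v x) (b * v y) := dist_add_add_le _ _ _ _
      _ = a * dist (u x) (u y) + b * dist (v x) (v y) := by
        simp only [Real.dist_eq, ← mul_sub, abs_mul, NNReal.abs_eq]
      _ ≤ a * (K * dist x y) + b * (L * dist x y) := by gcongr
      _ = _ := by push_cast; ring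
  refine (iInf₂_le (fun x => a * u x + b * v x) ⟨⟨_, huv⟩, ?bdd, ?ae⟩).trans ?energy
  case bdd =>
    refine (hub.union hvb).subset (closure_minimal (fun x hx => ?_)
      ((isClosed_tsupport u).union (isClosed_tsupport v)))
    by_contra h
    simp only [Set.mem_union, not_or] at h
    exact hx (by simp [image_eq_zero_of_notMem_tsupport h.1, image_eq_zero_of_notMem_tsupport h.2])
  case ae =>
    filter_upwards [Lp.coeFn_add ((a : ℝ) • f) ((b : ℝ) • g), Lp.coeFn_smul (a : ℝ) f,
      Lp.coeFn_smul (b : ℝ) g, hfu, hgv] with x h1 h2 h3 h4 h5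
    rw [h1, Pi.add_apply, h2, h3, Pi.smul_apply, Pi.smul_apply, h4, h5, smul_eq_mul, smul_eq_mul]
  case energy =>
    have hab' : (a : ℝ≥0∞) + b = 1 := by exact_mod_cast hab
    have hmeas := (measurable_asymptoticSlope u).pow_const p.toReal
    calc ENNReal.ofReal (1 / p.toReal)
          * ∫⁻ x, asymptoticSlope (fun y => a * u y + b * v y) x ^ p.toReal ∂m
        ≤ ENNReal.ofReal (1 / p.toReal) * ∫⁻ x, (a * asymptoticSlope u x ^ p.toReal
            + b * asymptoticSlope v x ^ p.toReal) ∂m := by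
          gcongr with x
          refine (ENNReal.rpow_le_rpow (asymptoticSlope_add_smul_le u v a b x)
            (by linarith)).trans ?_
          exact ENNReal.rpow_arith_mean_le_arith_mean2_rpow _ _ _ _ hab' hq1
      _ = a * (ENNReal.ofReal (1 / p.toReal) * ∫⁻ x, asymptoticSlope u x ^ p.toReal ∂m)
          + b * (ENNReal.ofReal (1 / p.toReal) * ∫⁻ x, asymptoticSlope v x ^ p.toReal ∂m) := by
          rw [lintegral_add_left (hmeas.const_mul _),
            lintegral_const_mul' _ _ ENNReal.coe_ne_top, lintegral_const_mul' _ _ ENNReal.coe_ne_top]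
          ring
      _ ≤ a * c + b * c := by gcongr
      _ = c := by rw [← add_mul, hab', one_mul]

theorem convex_setOf_cheegerEnergy_le (D : MetricSpace X) [OpensMeasurableSpace X]
    (hp : p ≠ ∞) (c : ℝ≥0∞) : Convex ℝ {f : Lp ℝ p m | cheegerEnergy D m p f ≤ c} := by
  intro f hf g hg a b ha hb hab
  lift a to NNReal using ha
  lift b to NNReal using hb
  have hab' : a + b = 1 := by exact_mod_cast hab
  by_cases hc : c = ∞
  · simp [hc]
  refine (cheegerEnergy_le_iff D).2 fun ε hε δ hδ => ?_
  have hε2 : ε / 2 ≠ 0 := by simpa using hε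
  -- The cap by `1` keeps the bound finite even for `ε = ∞`, so that adding `ε / 2` makes it
  -- strictly larger.
  obtain ⟨u, hu, hu'⟩ := (cheegerEnergy_le_iff D).1 hf (min 1 (ε / 2)) (by simp [hε]) δ hδ
  obtain ⟨v, hv, hv'⟩ := (cheegerEnergy_le_iff D).1 hg (min 1 (ε / 2)) (by simp [hε]) δ hδ
  have hfin : c + min 1 (ε / 2) ≠ ∞ :=
    ENNReal.add_ne_top.2 ⟨hc, ((min_le_left _ _).trans_lt ENNReal.one_lt_top).ne⟩
  have hlt : c + min 1 (ε / 2) < c + min 1 (ε / 2) + ε / 2 := ENNReal.lt_add_right hfin hε2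
  refine ⟨(a : ℝ) • u + (b : ℝ) • v, ?_, (asymptoticEnergy_convexComb_le D hp hab'
    (hu'.trans_lt hlt) (hv'.trans_lt hlt)).trans ?_⟩
  · refine (dist_add_add_le _ _ _ _).trans_lt ?_
    rw [dist_smul₀, dist_smul₀, NNReal.norm_eq, NNReal.norm_eq]
    rcases eq_or_lt_of_le a.2 with h0 | h0
    · have ha0 : (a : ℝ) = 0 := h0.symm
      rw [ha0] at hab ⊢
      rw [zero_add] at hab
      simpa [hab] using hv
    · have h1 : (a : ℝ) * dist u f < a * δ := mul_lt_mul_of_pos_left hu h0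
      have h2 : (b : ℝ) * dist v g ≤ b * δ := mul_le_mul_of_nonneg_left hv.le b.2
      calc _ < (a : ℝ) * δ + b * δ := add_lt_add_of_lt_of_le h1 h2
        _ = δ := by rw [← add_mul, hab, one_mul]
  · rw [add_assoc]
    gcongr
    exact (add_le_add_left (min_le_right _ _) _).trans (ENNReal.add_halves ε).le

/-- Sublevel sets of the Cheeger energy are weakly sequentially closed. -/
theorem cheegerEnergy_le_liminf_of_weaklyConverges (D : MetricSpace X) [OpensMeasurableSpace X]
    (hp : p ≠ ∞) {f : Lp ℝ p m} {u : ℕ → Lp ℝ p m} (hu : WeaklyConverges u f) :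
    cheegerEnergy D m p f ≤ liminf (fun i => cheegerEnergy D m p (u i)) atTop := by
  by_contra! hlt
  obtain ⟨c, hc1, hc2⟩ := exists_between hlt
  have hfreq := frequently_lt_of_liminf_lt (by isBoundedDefault) hc1
  -- The closed convex sublevel set at `c` misses `f` but contains `u i` for infinitely many `i`; a
  -- separating functional contradicts weak convergence.
  obtain ⟨φ, s, hs1, hs2⟩ := geometric_hahn_banach_point_closed
    (convex_setOf_cheegerEnergy_le (m := m) D hp c) (isClosed_setOf_cheegerEnergy_le D c)
    (x := f) (by simpa using hc2)
  obtain ⟨i, hi, hi'⟩ := (hfreq.and_eventually ((hu φ).eventually_lt_const hs1)).exists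
  exact (hs2 (u i) hi.le).not_gt hi'

/-- Removes the bounded-support requirement. A cutoff with Lipschitz constant `1 / (n + 1)` adds at
most `|g| / (n + 1)` to the slope, which disappears by dominated convergence. Boundedness of `g`
keeps the products Lipschitz. -/
theorem cheegerEnergy_le_of_lipschitz (D : MetricSpace X) [OpensMeasurableSpace X] (hp : p ≠ ∞)
    {h : Lp ℝ p m} {g : X → ℝ} {K : NNReal} (hK : LipschitzWith K g)
    {C : NNReal} (hC : ∀ x, ‖g x‖ ≤ C) (hg : h =ᵐ[m] g) (x₀ : X) :
    cheegerEnergy D m p h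
      ≤ ENNReal.ofReal (1 / p.toReal) * ∫⁻ x, asymptoticSlope g x ^ p.toReal ∂m := by
  have hp0 : p ≠ 0 := (zero_lt_one.trans_le (Fact.out : 1 ≤ p)).ne'
  have hq : 0 < p.toReal := ENNReal.toReal_pos hp0 hp
  have hq1 : 1 ≤ p.toReal := by
    rw [← ENNReal.toReal_one]
    exact ENNReal.toReal_mono hp Fact.out
  by_cases hfin : ∫⁻ x, asymptoticSlope g x ^ p.toReal ∂m = ∞
  · rw [hfin, ENNReal.mul_top (by simpa using hq)]
    exact le_top
  have hgm : MemLp g p m := (memLp_congr_ae hg).1 (Lp.memLp h)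
  have hgm' : ∫⁻ x, ‖g x‖ₑ ^ p.toReal ∂m < ∞ :=
    lintegral_rpow_enorm_lt_top_of_eLpNorm_lt_top hp0 hp hgm.2
  have hgmeas : Measurable fun x => ‖g x‖ₑ := hK.continuous.measurable.enorm
  have hηL := fun n : ℕ => lipschitzWith_mul_of_norm_le hK (lipschitzWith_ballCutoff x₀ n) hC
    (norm_ballCutoff_le_one x₀ n)
  have hmem : ∀ n : ℕ, MemLp (fun x => g x * ballCutoff x₀ n x) p m := by
    intro n
    refine hgm.of_le (hηL n).continuous.aestronglyMeasurable (Eventually.of_forall fun x => ?_)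
    rw [norm_mul]
    exact mul_le_of_le_one_right (norm_nonneg _) (norm_ballCutoff_le_one x₀ n x)
  have hinv : Tendsto (fun n : ℕ => ((((n : NNReal) + 1)⁻¹ : NNReal) : ℝ≥0∞)) atTop (𝓝 0) := by
    have h1 : Tendsto (fun n : ℕ => (((n + 1 : ℕ) : ℝ≥0∞))⁻¹) atTop (𝓝 0) :=
      ENNReal.tendsto_inv_nat_nhds_zero.comp (tendsto_add_atTop_nat 1)
    refine h1.congr fun n => ?_
    rw [ENNReal.coe_inv (by positivity)]
    push_cast
    rfl
  have hconv : Tendsto (fun n => (hmem n).toLp) atTop (𝓝 h) := by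
    rw [← Lp.toLp_coeFn h (Lp.memLp h), Lp.tendsto_Lp_iff_tendsto_eLpNorm'']
    have h0 : Tendsto (fun n : ℕ => ∫⁻ x, ‖g x * ballCutoff x₀ n x - g x‖ₑ ^ p.toReal ∂m) atTop
        (𝓝 (∫⁻ _, 0 ∂m)) := by
      refine tendsto_lintegral_of_dominated_convergence (fun x => ‖g x‖ₑ ^ p.toReal)
        (fun n => ?_) (fun n => Eventually.of_forall fun x => ?_) hgm'.ne
        (Eventually.of_forall fun x => ?_)
      · exact (((hηL n).continuous.sub hK.continuous).measurable.enorm).pow_const _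
      · refine ENNReal.rpow_le_rpow ?_ hq.le
        refine enorm_le_iff_norm_le.2 ?_
        rw [show g x * ballCutoff x₀ n x - g x = g x * (ballCutoff x₀ n x - 1) by ring, norm_mul]
        refine mul_le_of_le_one_right (norm_nonneg _) ?_
        rw [Real.norm_eq_abs, abs_le]
        constructor <;> linarith [ballCutoff_nonneg x₀ n x, ballCutoff_le_one x₀ n x]
      · refine tendsto_const_nhds.congr' ?_
        filter_upwards [eventually_ballCutoff_eq_one x₀ x] with n hn
        simp [hn, hq]
    have h1 := (ENNReal.continuous_rpow_const (y := 1 / p.toReal)).tendsto _ |>.comp h0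
    rw [lintegral_zero, ENNReal.zero_rpow_of_pos (by positivity)] at h1
    refine h1.congr fun n => ?_
    rw [Function.comp_apply, ← eLpNorm_eq_lintegral_rpow_enorm_toReal hp0 hp]
    refine eLpNorm_congr_ae ?_
    filter_upwards [hg] with x hx
    simp [hx]
  have hlim : Tendsto (fun n : ℕ => ∫⁻ x, (asymptoticSlope g x
      + (((n : NNReal) + 1)⁻¹ : NNReal) * ‖g x‖ₑ) ^ p.toReal ∂m) atTop
      (𝓝 (∫⁻ x, asymptoticSlope g x ^ p.toReal ∂m)) := by
    refine tendsto_lintegral_of_dominated_convergence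
      (fun x => (asymptoticSlope g x + ‖g x‖ₑ) ^ p.toReal)
        (fun n => ?_) (fun n => Eventually.of_forall fun x => ?_) ?_
        (Eventually.of_forall fun x => ?_)
    · exact ((measurable_asymptoticSlope g).add (hgmeas.const_mul _)).pow_const _
    · refine ENNReal.rpow_le_rpow (add_le_add_right (mul_le_of_le_one_left' ?_) _) hq.le
      rw [ENNReal.coe_le_one_iff]
      exact inv_le_one_of_one_le₀ (by simp)
    · exact (ENNReal.lintegral_rpow_add_lt_top_of_lintegral_rpow_lt_top
        (measurable_asymptoticSlope g).aemeasurable (lt_top_iff_ne_top.2 hfin) hgm' hq1).ne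
    · refine (ENNReal.continuous_rpow_const.tendsto _).comp ?_
      have := (ENNReal.Tendsto.mul_const hinv (b := ‖g x‖ₑ) (Or.inr enorm_ne_top))
      simpa using tendsto_const_nhds.add this
  have hle : ∀ n : ℕ, asymptoticEnergy D m p (hmem n).toLp ≤ ENNReal.ofReal (1 / p.toReal)
      * ∫⁻ x, (asymptoticSlope g x
        + (((n : NNReal) + 1)⁻¹ : NNReal) * ‖g x‖ₑ) ^ p.toReal ∂m := by
    intro n
    refine (iInf₂_le _ ⟨⟨_, hηL n⟩, isBounded_tsupport_mul_ballCutoff x₀ n g,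
      (hmem n).coeFn_toLp⟩).trans ?_
    gcongr with x
    refine asymptoticSlope_mul_le hK (lipschitzWith_ballCutoff x₀ n) (fun y => ?_) x
    simpa using enorm_le_iff_norm_le.2
      ((norm_ballCutoff_le_one x₀ n y).trans (by simp : (1 : ℝ) ≤ ‖(1 : ℝ)‖))
  have hCh : cheegerEnergy D m p h
      ≤ liminf (fun n => asymptoticEnergy D m p (hmem n).toLp) atTop :=
    iInf₂_le (fun n => (hmem n).toLp) hconv
  refine hCh.trans (le_trans (liminf_le_liminf (Eventually.of_forall hle)) ?_)
  exact (ENNReal.Tendsto.const_mul hlim (Or.inr ENNReal.ofReal_ne_top)).liminf_eq.le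

theorem cheegerEnergy_le_of_dist_le (D' D : MetricSpace X) [OpensMeasurableSpace X]
    (hle : ∀ x y : X, D'.dist x y ≤ D.dist x y) (hp : p ≠ ∞)
    [Nonempty X] (f : Lp ℝ p m) : cheegerEnergy D m p f ≤ cheegerEnergy D' m p f := by
  refine cheegerEnergy_le_of_approx D fun ε hε δ hδ => ?_
  obtain ⟨h, hh, hE⟩ := (cheegerEnergy_le_iff D' (f := f)).1 le_rfl ε hε δ hδ
  refine ⟨h, hh, le_trans (le_iInf₂ fun g hg => ?_) hE⟩
  obtain ⟨⟨K, hK⟩, hb, hae⟩ := hg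
  obtain ⟨C, hC⟩ := @LipschitzWith.exists_norm_le_of_isBounded_tsupport X D' g K hK hb
  refine (cheegerEnergy_le_of_lipschitz D hp (lipschitzWith_of_dist_le D' hle hK)
    hC hae (Classical.arbitrary X)).trans ?_
  gcongr with x
  exact asymptoticSlope_le_of_dist_le D' hle g x

end Energy

/-! ### Infima over discrete weighted paths. -/

section DiscretePath

variable {Y : Type*} [MetricSpace Y]

/-- The first `n + 1` points of `c` form a discrete path from `x` whose steps are at most `s`. -/
def IsDiscretePath (s : ℝ) (x : Y) (n : ℕ) (c : ℕ → Y) : Prop :=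
  c 0 = x ∧ ∀ k < n, dist (c k) (c (k + 1)) ≤ s

/-- The cost of a discrete path for the weight `W`. -/
noncomputable def pathCost (W : Y → NNReal) (c : ℕ → Y) (n : ℕ) : ℝ :=
  ∑ k ∈ Finset.range n, W (c (k + 1)) * dist (c k) (c (k + 1))

/-- The infimum of `g` at the end point plus the cost, over all discrete paths from `x` with steps
at most `s`. -/
noncomputable def discreteInf (g : Y → ℝ) (W : Y → NNReal) (s : ℝ) (x : Y) : ℝ :=
  ⨅ c : {c : ℕ × (ℕ → Y) // IsDiscretePath s x c.1 c.2},
    (g (c.1.2 c.1.1) + pathCost W c.1.2 c.1.1)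

variable {g : Y → ℝ} {W : Y → NNReal} {s : ℝ}

theorem pathCost_nonneg (W : Y → NNReal) (c : ℕ → Y) (n : ℕ) : 0 ≤ pathCost W c n :=
  Finset.sum_nonneg fun _ _ => by positivity

theorem pathCost_mono (W : Y → NNReal) (c : ℕ → Y) : Monotone (pathCost W c) :=
  monotone_nat_of_le_succ fun n => by
    rw [pathCost, pathCost, Finset.sum_range_succ]
    have : 0 ≤ (W (c (n + 1)) : ℝ) * dist (c n) (c (n + 1)) := by positivity
    linarith

instance nonempty_discretePath (s : ℝ) (x : Y) :
    Nonempty {c : ℕ × (ℕ → Y) // IsDiscretePath s x c.1 c.2} :=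
  ⟨⟨(0, fun _ => x), rfl, fun _ h => absurd h (Nat.not_lt_zero _)⟩⟩

theorem discreteInf_le (hg : ∀ x, 0 ≤ g x) {x : Y} {n : ℕ} {c : ℕ → Y}
    (hc : IsDiscretePath s x n c) : discreteInf g W s x ≤ g (c n) + pathCost W c n := by
  refine ciInf_le (f := fun c : {c : ℕ × (ℕ → Y) // IsDiscretePath s x c.1 c.2} =>
    (g (c.1.2 c.1.1) + pathCost W c.1.2 c.1.1)) ⟨0, ?_⟩ ⟨(n, c), hc⟩
  rintro _ ⟨c, rfl⟩
  exact add_nonneg (hg _) (pathCost_nonneg _ _ _)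

theorem le_discreteInf {x : Y} {a : ℝ}
    (h : ∀ n c, IsDiscretePath s x n c → a ≤ g (c n) + pathCost W c n) :
    a ≤ discreteInf g W s x :=
  le_ciInf fun c => h _ _ c.2

theorem discreteInf_nonneg (hg : ∀ x, 0 ≤ g x) (x : Y) : 0 ≤ discreteInf g W s x :=
  le_discreteInf fun _ _ _ => add_nonneg (hg _) (pathCost_nonneg _ _ _)

theorem discreteInf_le_self (hg : ∀ x, 0 ≤ g x) (x : Y) : discreteInf g W s x ≤ g x := by
  simpa [pathCost] using discreteInf_le (W := W) (s := s) hg (x := x) (n := 0) (c := fun _ => x)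
    ⟨rfl, fun _ h => absurd h (Nat.not_lt_zero _)⟩

/-- The weight sits at the far end of each step, so prefixing `y` to a path from `z` costs exactly
`W z * dist y z`. -/
theorem discreteInf_le_add (hg : ∀ x, 0 ≤ g x) {y z : Y} (h : dist y z ≤ s) :
    discreteInf g W s y ≤ discreteInf g W s z + W z * dist y z := by
  rw [← sub_le_iff_le_add]
  refine le_discreteInf fun n c hc => ?_
  let c' : ℕ → Y := fun k => Nat.casesOn k y c
  have hc' : IsDiscretePath s y (n + 1) c' := by
    refine ⟨rfl, fun k hk => ?_⟩
    cases k with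
    | zero => simpa [c', hc.1] using h
    | succ k => exact hc.2 k (by omega)
  have h1 := discreteInf_le (W := W) hg hc'
  have h2 : pathCost W c' (n + 1) = pathCost W c n + W z * dist y z := by
    rw [pathCost, Finset.sum_range_succ']
    simp [c', hc.1, pathCost]
  rw [h2] at h1
  change _ ≤ g (c n) + _ at h1
  linarith

theorem abs_discreteInf_sub_le (hg : ∀ x, 0 ≤ g x) {y z : Y} (h : dist y z ≤ s) {w : NNReal}
    (hy : W y ≤ w) (hz : W z ≤ w) :
    |discreteInf g W s y - discreteInf g W s z| ≤ w * dist y z := by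
  have h1 := discreteInf_le_add (W := W) hg h
  have h2 := discreteInf_le_add (W := W) (s := s) hg (y := z) (z := y) (dist_comm y z ▸ h)
  have h3 : (W y : ℝ) * dist y z ≤ w * dist y z := by gcongr
  have h4 : (W z : ℝ) * dist y z ≤ w * dist y z := by gcongr
  rw [dist_comm z y] at h2
  rw [abs_le]
  constructor <;> linarith

/-- Points within `s` are one step apart; beyond `s` the oscillation, at most `M`, is at most `M /
s` times the distance. -/
theorem lipschitzWith_discreteInf (hg : ∀ x, 0 ≤ g x) {M C : NNReal} (hM : ∀ x, g x ≤ M)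
    (hC : ∀ x, W x ≤ C) {s : NNReal} (hs : 0 < s) :
    LipschitzWith (max C (M / s)) (discreteInf g W s) := by
  refine LipschitzWith.of_dist_le_mul fun y z => ?_
  rw [Real.dist_eq]
  rcases le_total (dist y z) s with h | h
  · exact abs_discreteInf_sub_le hg h ((hC y).trans (le_max_left _ _))
      ((hC z).trans (le_max_left _ _))
  · have h1 : |discreteInf g W s y - discreteInf g W s z| ≤ M := by
      have := discreteInf_nonneg (W := W) (s := s) hg
      have h' := fun x => (discreteInf_le_self (W := W) (s := s) hg x).trans (hM x)
      rw [abs_le]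
      constructor <;> linarith [this y, this z, h' y, h' z]
    have hs' : (0 : ℝ) < s := hs
    calc _ ≤ (M : ℝ) := h1
      _ = (M / s : ℝ) * s := by field_simp
      _ ≤ (max C (M / s) : NNReal) * dist y z := by
        gcongr
        exact_mod_cast le_max_right C (M / s)

/-- A path whose points satisfy `δ ≤ dist + κ` cannot decrease `g` by much more than its cost, if
the weight controls the oscillation of `g` with respect to `δ` at the scale `r`. -/
theorem sub_le_mul_pathCost (δ : Y → Y → ℝ) {L : NNReal} {r t κ : ℝ} (ht : 0 < t) (hκ : 0 ≤ κ)
    (htr : t + s + κ < r) (hgL : ∀ y z, |g y - g z| ≤ L * δ y z)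
    (hgW : ∀ x y z, δ x y < r → δ x z < r → |g y - g z| ≤ W x * δ y z) (n : ℕ) :
    ∀ c : ℕ → Y, (∀ k < n, dist (c k) (c (k + 1)) ≤ s) →
      (∀ k ≤ n, ∀ l ≤ n, δ (c k) (c l) ≤ dist (c k) (c l) + κ) →
      g (c 0) - g (c n) ≤ (1 + κ / t) * pathCost W c n + L * (t + κ) := by
  induction n using Nat.strong_induction_on with
  | _ n ih =>
  intro c hs hδ
  set len : ℕ → ℝ := fun b => ∑ k ∈ Finset.range b, dist (c k) (c (k + 1)) with hlen
  have hdist : ∀ k l b, k ≤ b → l ≤ b → dist (c k) (c l) ≤ len b := by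
    have key : ∀ k l b, k ≤ l → l ≤ b → dist (c k) (c l) ≤ len b := by
      intro k l b hkl hlb
      refine (dist_le_Ico_sum_dist c hkl).trans ?_
      refine Finset.sum_le_sum_of_subset_of_nonneg (fun i hi => ?_) fun _ _ _ => dist_nonneg
      simp only [Finset.mem_Ico, Finset.mem_range] at hi ⊢
      omega
    intro k l b hk hl
    rcases le_total k l with h | h
    · exact key k l b h hl
    · rw [dist_comm]
      exact key l k b h hk
  have hκt : 0 ≤ κ / t := by positivity
  by_cases hn : len n < t
  · have h1 := (le_abs_self _).trans (hgL (c 0) (c n))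
    have h2 : (L : ℝ) * δ (c 0) (c n) ≤ L * (t + κ) := by
      gcongr
      linarith [hδ 0 n.zero_le n le_rfl, hdist 0 n n n.zero_le le_rfl]
    have h3 : 0 ≤ (1 + κ / t) * pathCost W c n :=
      mul_nonneg (by linarith) (pathCost_nonneg _ _ _)
    linarith
  -- Cut off the first piece of length at least `t`; its length is at most `t + s`. Comparing `δ`
  -- with `dist` once per piece turns `κ` into the relative error `κ / t`; comparing at every step
  -- would accumulate it.
  · have hex : ∃ b, t ≤ len b := ⟨n, not_lt.1 hn⟩
    obtain ⟨b, hb⟩ : ∃ b, b + 1 = Nat.find hex := by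
      refine Nat.exists_eq_add_one.2 (Nat.pos_of_ne_zero fun h => ?_) |>.imp fun _ h => h.symm
      have := Nat.find_spec hex
      rw [h] at this
      simp [hlen] at this
      linarith
    have hb1 : t ≤ len (b + 1) := hb ▸ Nat.find_spec hex
    have hb2 : len b < t := not_le.1 (Nat.find_min hex (by omega))
    have hbn : b + 1 ≤ n := hb ▸ Nat.find_min' hex (not_lt.1 hn)
    have hb3 : len (b + 1) ≤ t + s := by
      simp only [hlen, Finset.sum_range_succ] at hb2 ⊢
      linarith [hs b hbn]
    have hG : ∀ k < b + 1, g (c 0) - g (c (b + 1))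
        ≤ W (c (k + 1)) * ((1 + κ / t) * len (b + 1)) := by
      intro k hk
      have hlt : ∀ l ≤ b + 1, δ (c (k + 1)) (c l) < r := by
        intro l hl
        linarith [hδ (k + 1) (by omega) l (by omega), hdist (k + 1) l (b + 1) (by omega) hl]
      refine ((le_abs_self _).trans (hgW (c (k + 1)) (c 0) (c (b + 1)) (hlt 0 (by omega))
        (hlt (b + 1) le_rfl))).trans ?_
      gcongr
      have h1 := hδ 0 (by omega) (b + 1) hbn
      have h2 := hdist 0 (b + 1) (b + 1) (by omega) le_rfl
      have h3 : κ ≤ κ / t * len (b + 1) := by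
        calc κ = κ / t * t := by field_simp
          _ ≤ _ := by gcongr
      linarith
    have hpos : 0 < len (b + 1) := ht.trans_le hb1
    -- Every vertex weight controls the drop across the whole piece; averaging `hG` with the step
    -- lengths as weights produces the cost.
    have hfirst : g (c 0) - g (c (b + 1)) ≤ (1 + κ / t) * pathCost W c (b + 1) := by
      refine le_of_mul_le_mul_right ?_ hpos
      calc (g (c 0) - g (c (b + 1))) * len (b + 1)
          = ∑ k ∈ Finset.range (b + 1), (g (c 0) - g (c (b + 1))) * dist (c k) (c (k + 1)) := by
            rw [← Finset.mul_sum]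
        _ ≤ ∑ k ∈ Finset.range (b + 1), (W (c (k + 1)) * ((1 + κ / t) * len (b + 1)))
            * dist (c k) (c (k + 1)) := by
            refine Finset.sum_le_sum fun k hk => ?_
            gcongr
            exact hG k (Finset.mem_range.1 hk)
        _ = (1 + κ / t) * pathCost W c (b + 1) * len (b + 1) := by
            generalize len (b + 1) = ℓ
            rw [pathCost, mul_assoc, Finset.sum_mul, Finset.mul_sum]
            exact Finset.sum_congr rfl fun _ _ => by ring
    obtain ⟨n', rfl⟩ := Nat.exists_eq_add_of_le hbn
    have hrest := ih n' (by omega) (fun k => c (b + 1 + k)) (fun k hk => hs _ (by omega))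
      fun k hk l hl => hδ _ (by omega) _ (by omega)
    have hcost : pathCost W c (b + 1 + n')
        = pathCost W c (b + 1) + pathCost W (fun k => c (b + 1 + k)) n' := by
      simp only [pathCost, Finset.sum_range_add, add_assoc]
    simp only [add_zero] at hrest
    rw [hcost, mul_add]
    linarith

/-- A path of small cost stays close to a set outside which the weight is large. -/
theorem exists_dist_le_add_pathCost {K S : Set Y} {a Λ : ℝ} (ha : 0 ≤ a) (hΛ : 0 < Λ)
    (hW : ∀ y ∈ S, (∃ q ∈ K, dist y q ≤ a) ∨ Λ ≤ W y) {c : ℕ → Y} (h0 : c 0 ∈ K) (n : ℕ)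
    (hc : ∀ k < n, c (k + 1) ∈ S) : ∃ q ∈ K, dist (c n) q ≤ a + pathCost W c n / Λ := by
  induction n with
  | zero => exact ⟨c 0, h0, by simpa [pathCost] using ha⟩
  | succ n ih =>
    -- A step ending near `K` resets the distance; any other has length at most its cost divided by
    -- `Λ`.
    rcases hW (c (n + 1)) (hc n n.lt_succ_self) with ⟨q, hq, hd⟩ | h
    · exact ⟨q, hq, hd.trans (le_add_of_nonneg_right
        (div_nonneg (pathCost_nonneg _ _ _) hΛ.le))⟩
    · obtain ⟨q, hq, hd⟩ := ih fun k hk => hc k (by omega)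
      refine ⟨q, hq, ?_⟩
      have h1 : dist (c n) (c (n + 1)) ≤ W (c (n + 1)) * dist (c n) (c (n + 1)) / Λ := by
        rw [le_div_iff₀ hΛ, mul_comm]
        gcongr
      have h2 := dist_triangle_left (c (n + 1)) q (c n)
      rw [pathCost, Finset.sum_range_succ, add_div, ← pathCost]
      linarith

/-- Paths of cost at least `M` are harmless since `g ≤ M`. Cheaper ones stay near every `K j` with
`j < N`, where `δ` and `dist` compare, so `sub_le_mul_pathCost` applies. In the application `dist`
is that of `d i` and `δ` that of `D`. -/
theorem sub_le_discreteInf (δ : Y → Y → ℝ) {L : NNReal} {r t κ M : ℝ} (ht : 0 < t) (hκ : 0 ≤ κ)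
    (htr : t + s + κ < r) (hgL : ∀ y z, |g y - g z| ≤ L * δ y z)
    (hgW : ∀ x y z, δ x y < r → δ x z < r → |g y - g z| ≤ W x * δ y z)
    (hg : ∀ x, 0 ≤ g x) (hM : ∀ x, g x ≤ M) {S : Set Y} (hS : ∀ x ∉ S, g x = 0)
    {N : ℕ} {K : ℕ → Set Y} (hsN : ∀ j < N, s ≤ 1 / ((j : ℝ) + 1))
    (hW : ∀ j < N, ∀ y ∈ S, (∃ q ∈ K j, dist y q ≤ 1 / ((j : ℝ) + 1)) ∨ (j : ℝ) + 1 ≤ W y)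
    (hδ : ∀ y z, (∀ j < N, ∃ q ∈ K j, dist y q ≤ (M + 2) / ((j : ℝ) + 1)) →
      (∀ j < N, ∃ q ∈ K j, dist z q ≤ (M + 2) / ((j : ℝ) + 1)) → δ y z ≤ dist y z + κ)
    {x : Y} (hx : ∀ j < N, x ∈ K j) :
    g x - (κ / t * M + L * (t + κ)) ≤ discreteInf g W s x := by
  refine le_discreteInf fun n c hc => ?_
  have herr : 0 ≤ κ / t * M + L * (t + κ) := by
    have : 0 ≤ M := (hg x).trans (hM x)
    positivity
  rcases le_total M (pathCost W c n) with hcost | hcost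
  · linarith [hM x, hg (c n)]
  classical
  -- The weight confines paths only inside `S`. Stopping at the first exit is free, because `g`
  -- vanishes there.
  obtain ⟨n', hn', hin, hend⟩ : ∃ n' ≤ n, (∀ k < n', c k ∈ S) ∧ (n' = n ∨ c n' ∉ S) := by
    by_cases hex : ∃ k, k ≤ n ∧ c k ∉ S
    · refine ⟨Nat.find hex, (Nat.find_spec hex).1, fun k hk => ?_, Or.inr (Nat.find_spec hex).2⟩
      by_contra hkS
      exact Nat.find_min hex hk ⟨hk.le.trans (Nat.find_spec hex).1, hkS⟩
    · push Not at hex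
      exact ⟨n, le_rfl, fun k hk => hex k hk.le, Or.inl rfl⟩
  have hclose : ∀ k ≤ n', ∀ j < N, ∃ q ∈ K j, dist (c k) q ≤ (M + 2) / ((j : ℝ) + 1) := by
    intro k hk j hj
    have hj0 : (0 : ℝ) < (j : ℝ) + 1 := by positivity
    have hM0 : 0 ≤ M := (hg x).trans (hM x)
    cases k with
    | zero =>
      refine ⟨c 0, hc.1 ▸ hx j hj, ?_⟩
      rw [dist_self]
      positivity
    -- The last step may leave `S` and is paid for separately: `M + 2` is `1` for closeness, `M` for
    -- the cost and `1` for that step.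
    | succ k =>
      obtain ⟨q, hq, hd⟩ := exists_dist_le_add_pathCost (by positivity) hj0 (hW j hj)
        (c := c) (hc.1 ▸ hx j hj) k fun i hi => hin (i + 1) (by omega)
      refine ⟨q, hq, ?_⟩
      have h1 := hc.2 k (by omega)
      have h2 := dist_triangle_left (c (k + 1)) q (c k)
      have h3 : pathCost W c k / ((j : ℝ) + 1) ≤ M / ((j : ℝ) + 1) := by
        gcongr
        exact (pathCost_mono W c (by omega)).trans hcost
      have h4 : (M + 2) / ((j : ℝ) + 1)
          = 1 / ((j : ℝ) + 1) + M / ((j : ℝ) + 1) + 1 / ((j : ℝ) + 1) := by ring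
      linarith [hsN j hj]
  have hmain := sub_le_mul_pathCost δ ht hκ htr hgL hgW n' c (fun k hk => hc.2 k (by omega))
    fun k hk l hl => hδ _ _ (hclose k hk) (hclose l hl)
  have hgn : g (c n') ≤ g (c n) := by
    rcases hend with rfl | h
    · exact le_rfl
    · rw [hS _ h]
      exact hg _
  have h1 := pathCost_mono W c hn'
  have h2 : κ / t * pathCost W c n' ≤ κ / t * M := by
    gcongr
    exact h1.trans hcost
  rw [hc.1] at hmain
  linarith


/-- The difference of the discrete infima of the positive and the negative part of `g`, each
truncated at level `e`. -/
noncomputable def truncatedDiscreteInf (g : Y → ℝ) (W : Y → NNReal) (s e : ℝ) (x : Y) : ℝ :=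
  max (discreteInf (fun y => max (g y) 0) W s x - e) 0
    - max (discreteInf (fun y => max (-g y) 0) W s x - e) 0

theorem max_zero_nonneg {Y : Type*} (g : Y → ℝ) (x : Y) : 0 ≤ max (g x) 0 := le_max_right _ _

theorem abs_max_sub_max_zero_le (a b e : ℝ) : |max (a - e) 0 - max (b - e) 0| ≤ |a - b| := by
  simpa using abs_max_sub_max_le_abs (a - e) (b - e) 0

theorem lipschitzWith_truncatedDiscreteInf {M C : NNReal} (hM : ∀ x, |g x| ≤ M)
    (hC : ∀ x, W x ≤ C) {s : NNReal} (hs : 0 < s) (e : ℝ) :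
    LipschitzWith (max C (M / s) + max C (M / s)) (truncatedDiscreteInf g W s e) := by
  have h1 := lipschitzWith_discreteInf (max_zero_nonneg g) (M := M)
    (fun x => max_le ((le_abs_self _).trans (hM x)) M.2) hC hs
  have h2 := lipschitzWith_discreteInf (max_zero_nonneg fun y => -g y) (M := M)
    (fun x => max_le ((neg_le_abs _).trans (hM x)) M.2) hC hs
  refine LipschitzWith.of_dist_le_mul fun x y => ?_
  have h1' := h1.dist_le_mul x y
  have h2' := h2.dist_le_mul x y
  rw [Real.dist_eq] at h1' h2'
  refine (dist_sub_sub_le _ _ _ _).trans ?_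
  rw [NNReal.coe_add, add_mul]
  exact add_le_add ((abs_max_sub_max_zero_le _ _ e).trans h1')
    ((abs_max_sub_max_zero_le _ _ e).trans h2')

theorem truncatedDiscreteInf_of_nonneg {e : ℝ} (he : 0 ≤ e) {x : Y} (hx : 0 ≤ g x) :
    truncatedDiscreteInf g W s e x
      = max (discreteInf (fun y => max (g y) 0) W s x - e) 0 := by
  have h := discreteInf_le_self (W := W) (s := s) (max_zero_nonneg fun y => -g y) x
  rw [max_eq_right (by linarith : -g x ≤ 0)] at h
  rw [truncatedDiscreteInf, max_eq_right (a := discreteInf (fun y => max (-g y) 0) W s x - e)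
    (by linarith), sub_zero]

theorem truncatedDiscreteInf_neg (g : Y → ℝ) (W : Y → NNReal) (s e : ℝ) (x : Y) :
    truncatedDiscreteInf (fun y => -g y) W s e x = -truncatedDiscreteInf g W s e x := by
  simp only [truncatedDiscreteInf, neg_neg, neg_sub]

theorem truncatedDiscreteInf_eq_zero {e : ℝ} {x : Y} (hx : |g x| ≤ e) :
    truncatedDiscreteInf g W s e x = 0 := by
  have he : 0 ≤ e := (abs_nonneg _).trans hx
  have h1 := discreteInf_le_self (W := W) (s := s) (max_zero_nonneg g) x
  have h2 := discreteInf_le_self (W := W) (s := s) (max_zero_nonneg fun y => -g y) x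
  have h3 : max (g x) 0 ≤ e := max_le ((le_abs_self _).trans hx) he
  have h4 : max (-g x) 0 ≤ e := max_le ((neg_le_abs _).trans hx) he
  rw [truncatedDiscreteInf, max_eq_right (by linarith), max_eq_right (by linarith), sub_zero]

theorem abs_truncatedDiscreteInf_sub_le {e : ℝ} (he : 0 ≤ e) (x : Y) :
    |truncatedDiscreteInf g W s e x - g x| ≤ |g x| := by
  wlog hx : 0 ≤ g x generalizing g
  · have := this (g := fun y => -g y) (by linarith)
    rw [truncatedDiscreteInf_neg, abs_neg, ← abs_neg] at this
    convert this using 2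
    ring
  rw [truncatedDiscreteInf_of_nonneg he hx, abs_of_nonneg hx, abs_le]
  have h1 := discreteInf_le_self (W := W) (s := s) (max_zero_nonneg g) x
  rw [max_eq_left hx] at h1
  have h2 : max (discreteInf (fun y => max (g y) 0) W s x - e) 0 ≤ g x :=
    max_le (by linarith) hx
  have h3 := le_max_right (discreteInf (fun y => max (g y) 0) W s x - e) 0
  constructor <;> linarith

theorem abs_truncatedDiscreteInf_sub_le_of_le {e : ℝ} (he : 0 ≤ e) {x : Y}
    (h1 : max (g x) 0 - e ≤ discreteInf (fun y => max (g y) 0) W s x)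
    (h2 : max (-g x) 0 - e ≤ discreteInf (fun y => max (-g y) 0) W s x) :
    |truncatedDiscreteInf g W s e x - g x| ≤ 2 * e := by
  wlog hx : 0 ≤ g x generalizing g
  · have := this (g := fun y => -g y) h2 (by simpa using h1) (by linarith)
    rw [truncatedDiscreteInf_neg, ← abs_neg] at this
    convert this using 2
    ring
  rw [truncatedDiscreteInf_of_nonneg he hx, abs_le]
  have h3 := discreteInf_le_self (W := W) (s := s) (max_zero_nonneg g) x
  rw [max_eq_left hx] at h1 h3
  have h4 : max (discreteInf (fun y => max (g y) 0) W s x - e) 0 ≤ g x :=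
    max_le (by linarith) hx
  have h5 := le_max_left (discreteInf (fun y => max (g y) 0) W s x - e) 0
  constructor <;> linarith

/-- Near a point with `g x ≠ 0` only one of the two parts survives; near a zero of `g` the
truncation kills both. Hence the bound is `w` and not `2 * w`. -/
theorem asymptoticSlope_truncatedDiscreteInf_le (hg : Continuous g) (hs : 0 < s) {e : ℝ}
    (he : 0 < e) {x : Y} {w : NNReal} (hw : ∀ᶠ y in 𝓝 x, W y ≤ w) :
    asymptoticSlope (truncatedDiscreteInf g W s e) x ≤ w := by
  suffices h : ∃ Q : Y → Prop, (∀ᶠ y in 𝓝 x, Q y) ∧ ∀ y z, Q y → Q z → W y ≤ w → W z ≤ w →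
      dist y z ≤ s →
      |truncatedDiscreteInf g W s e y - truncatedDiscreteInf g W s e z| ≤ w * dist y z by
    obtain ⟨Q, hQ, h⟩ := h
    obtain ⟨r, hr, hball⟩ := Metric.eventually_nhds_iff.1 (hQ.and hw)
    have hr' : 0 < min r (s / 2) := lt_min hr (half_pos hs)
    refine (asymptoticSlope_le_lipConst hr').trans (lipConst_le_iff.2 fun y hy z hz => ?_)
    have hy1 := (Metric.mem_ball.1 hy).trans_le (min_le_left _ _)
    have hz1 := (Metric.mem_ball.1 hz).trans_le (min_le_left _ _)
    have hy2 := (Metric.mem_ball.1 hy).trans_le (min_le_right _ _)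
    have hz2 := (Metric.mem_ball.1 hz).trans_le (min_le_right _ _)
    have := h y z (hball hy1).1 (hball hz1).1 (hball hy1).2 (hball hz1).2
      (by linarith [dist_triangle_right y z x])
    rw [edist_dist, edist_dist, ← ENNReal.ofReal_coe_nnreal, ← ENNReal.ofReal_mul w.coe_nonneg]
    exact ENNReal.ofReal_le_ofReal this
  have hpos : ∀ g : Y → ℝ, ∀ y z, 0 ≤ g y → 0 ≤ g z → W y ≤ w → W z ≤ w → dist y z ≤ s →
      |truncatedDiscreteInf g W s e y - truncatedDiscreteInf g W s e z| ≤ w * dist y z := by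
    intro g y z hy hz hwy hwz hd
    rw [truncatedDiscreteInf_of_nonneg he.le hy, truncatedDiscreteInf_of_nonneg he.le hz]
    exact (abs_max_sub_max_zero_le _ _ e).trans
      (abs_discreteInf_sub_le (max_zero_nonneg g) hd hwy hwz)
  rcases lt_trichotomy (g x) 0 with hx | hx | hx
  · refine ⟨fun y => g y < 0, hg.continuousAt.eventually_lt_const hx,
      fun y z hy hz hwy hwz hd => ?_⟩
    have := hpos (fun y => -g y) y z (by linarith) (by linarith) hwy hwz hd
    rw [truncatedDiscreteInf_neg, truncatedDiscreteInf_neg, ← abs_neg] at this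
    convert this using 2
    ring
  · refine ⟨fun y => |g y| < e, hg.abs.continuousAt.eventually_lt_const (by simpa [hx] using he),
      fun y z hy hz _ _ _ => ?_⟩
    rw [truncatedDiscreteInf_eq_zero hy.le, truncatedDiscreteInf_eq_zero hz.le, sub_zero, abs_zero]
    positivity
  · exact ⟨fun y => 0 < g y, hg.continuousAt.eventually_const_lt hx,
      fun y z hy hz hwy hwz hd => hpos g y z hy.le hz.le hwy hwz hd⟩

end DiscretePath

/-! ### Compactness, tightness and uniform convergence of the distances. -/

theorem exists_tendsto_subseq_of_dist_isCompact_le {Y : Type*} [MetricSpace Y] [CompleteSpace Y]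
    {K : ℕ → Set Y} (hK : ∀ j, IsCompact (K j)) {b : ℕ → ℝ} (hb : Tendsto b atTop (𝓝 0))
    {u : ℕ → Y} (hu : ∀ N, ∀ j < N, ∃ q ∈ K j, dist (u N) q ≤ b j) :
    ∃ (a : Y) (φ : ℕ → ℕ), StrictMono φ ∧ Tendsto (u ∘ φ) atTop (𝓝 a) := by
  have htb : TotallyBounded (Set.range u) := by
    refine Metric.totallyBounded_iff.2 fun ε hε => ?_
    obtain ⟨j, hj⟩ := (hb.eventually_lt_const (half_pos hε)).exists
    obtain ⟨t, ht, hKt⟩ := Metric.totallyBounded_iff.1 (hK j).totallyBounded (ε / 2) (half_pos hε)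
    refine ⟨t ∪ u '' Set.Iic j, ht.union ((Set.finite_Iic j).image u), ?_⟩
    rintro _ ⟨N, rfl⟩
    rcases le_or_gt N j with hN | hN
    · exact Set.mem_iUnion₂.2 ⟨u N, Or.inr ⟨N, hN, rfl⟩, Metric.mem_ball_self hε⟩
    · obtain ⟨q, hq, hd⟩ := hu N j hN
      obtain ⟨y, hy, hqy⟩ := Set.mem_iUnion₂.1 (hKt hq)
      refine Set.mem_iUnion₂.2 ⟨y, Or.inl hy, ?_⟩
      rw [Metric.mem_ball] at hqy ⊢
      linarith [dist_triangle (u N) q y]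
  obtain ⟨a, -, φ, hφ, hlim⟩ := (htb.closure.isCompact_of_isClosed isClosed_closure)
    |>.tendsto_subseq fun n => subset_closure (Set.mem_range_self n)
  exact ⟨a, φ, hφ, hlim⟩

theorem continuous_dist_of_topology_eq {X : Type*} (D' : MetricSpace X) [D : MetricSpace X]
    (htop : D'.toUniformSpace.toTopologicalSpace = D.toUniformSpace.toTopologicalSpace) :
    Continuous fun q : X × X => D'.dist q.1 q.2 := by
  have h := @continuous_dist X D'.toPseudoMetricSpace
  rw [htop] at h
  exact h

section Approximation

variable {X : Type*} (d : ℕ → MetricSpace X) [D : MetricSpace X]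

/-- If distances inducing the same topology increase to `D`, then they converge uniformly on the
points that are close to sufficiently many of the compact sets `K j`. -/
theorem exists_forall_dist_le_add
    (hcomplete : @CompleteSpace X (d 0).toUniformSpace)
    (hmono : ∀ x y : X, Monotone fun i => (d i).dist x y)
    (hlim : ∀ x y : X, Tendsto (fun i => (d i).dist x y) atTop (𝓝 (D.dist x y)))
    (htop : ∀ i, (d i).toUniformSpace.toTopologicalSpace = D.toUniformSpace.toTopologicalSpace)
    {K : ℕ → Set X} (hK : ∀ j, IsCompact (K j)) {b : ℕ → ℝ} (hb : Tendsto b atTop (𝓝 0))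
    {κ : ℝ} (hκ : 0 < κ) :
    ∃ N, ∀ i ≥ N, ∀ y z, (∀ j < N, ∃ q ∈ K j, (d i).dist y q ≤ b j) →
      (∀ j < N, ∃ q ∈ K j, (d i).dist z q ≤ b j) → D.dist y z ≤ (d i).dist y z + κ := by
  -- Dini's argument: the bad pairs subconverge for `d 0`, hence for the common topology. Freezing
  -- `j` and using `d j ≤ d i` passes the gap `κ` to the limit pair, against pointwise convergence.
  by_contra! hcon
  choose i hi y z hy hz hyz using hcon
  have hcompact : ∀ u : ℕ → X, (∀ N, ∀ j < N, ∃ q ∈ K j, (d 0).dist (u N) q ≤ b j) →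
      ∃ (a : X) (φ : ℕ → ℕ), StrictMono φ ∧ Tendsto (u ∘ φ) atTop (𝓝 a) := by
    intro u hu
    have := @exists_tendsto_subseq_of_dist_isCompact_le X (d 0) hcomplete K
      (fun j => by rw [htop 0]; exact hK j) b hb u hu
    rwa [htop 0] at this
  have h0 : ∀ (i : ℕ) (y z : X), (d 0).dist y z ≤ (d i).dist y z :=
    fun i y z => hmono y z (Nat.zero_le i)
  obtain ⟨a, φ, hφ, ha⟩ := hcompact y fun N j hj =>
    (hy N j hj).imp fun q hq => ⟨hq.1, (h0 _ _ _).trans hq.2⟩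
  obtain ⟨a', ψ, hψ, ha'⟩ := hcompact (z ∘ φ) fun N j hj =>
    (hz (φ N) j (hj.trans_le (hφ.id_le N))).imp fun q hq => ⟨hq.1, (h0 _ _ _).trans hq.2⟩
  have hpair : Tendsto (fun n => (y (φ (ψ n)), z (φ (ψ n)))) atTop (𝓝 (a, a')) :=
    (ha.comp hψ.tendsto_atTop).prodMk_nhds ha'
  have hDlim : Tendsto (fun n => D.dist (y (φ (ψ n))) (z (φ (ψ n)))) atTop (𝓝 (D.dist a a')) :=
    ((continuous_dist_of_topology_eq D rfl).tendsto (a, a')).comp hpair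
  have hbound : ∀ j, (d j).dist a a' + κ ≤ D.dist a a' := by
    intro j
    have hj : Tendsto (fun n => (d j).dist (y (φ (ψ n))) (z (φ (ψ n)))) atTop
        (𝓝 ((d j).dist a a')) :=
      ((continuous_dist_of_topology_eq (d j) (htop j)).tendsto (a, a')).comp hpair
    refine le_of_tendsto_of_tendsto (hj.add_const κ) hDlim ?_
    filter_upwards [eventually_ge_atTop j] with n hn
    have h1 : j ≤ i (φ (ψ n)) :=
      hn.trans ((hψ.id_le n).trans ((hφ.id_le _).trans (hi _)))
    have h2 : (d j).dist _ _ ≤ (d (i (φ (ψ n)))).dist _ _ := hmono (y (φ (ψ n))) (z (φ (ψ n))) h1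
    linarith [hyz (φ (ψ n))]
  have := le_of_tendsto' ((hlim a a').add_const κ) hbound
  linarith

/-- Tightness of the finite measure `m.restrict B`. Adjoining `K 0` to each set lets paths starting
in `K 0` start in every `K j`. -/
theorem exists_isCompact_measure_diff_le [CompleteSpace X] [TopologicalSpace.SeparableSpace X]
    [MeasurableSpace X] [BorelSpace X] (m : Measure X) {B : Set X} (hB : m B < ∞)
    {η : ℕ → ℝ≥0∞} (hη : ∀ j, 0 < η j) :
    ∃ K : ℕ → Set X, (∀ j, IsCompact (K j)) ∧ (∀ j, K 0 ⊆ K j) ∧ ∀ j, m (B \ K j) ≤ η j := by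
  have : Fact (m B < ∞) := ⟨hB⟩
  have : SecondCountableTopology X := UniformSpace.secondCountable_of_separable X
  choose K hK hKη using fun j =>
    exists_isCompact_closure_measure_compl_lt (m.restrict B) (η j) (hη j)
  refine ⟨fun j => closure (K j) ∪ closure (K 0), fun j => (hK j).union (hK 0), fun j => ?_,
    fun j => ?_⟩
  · refine (Set.union_self _).subset.trans ?_
    exact Set.subset_union_right
  · have hclosed : IsClosed (closure (K j) ∪ closure (K 0)) :=
      isClosed_closure.union isClosed_closure
    calc m (B \ (closure (K j) ∪ closure (K 0)))
        = m.restrict B (closure (K j) ∪ closure (K 0))ᶜ := by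
          rw [Measure.restrict_apply hclosed.measurableSet.compl, Set.inter_comm, Set.sdiff_eq]
      _ ≤ m.restrict B (K j)ᶜ := by
          gcongr
          exact subset_closure.trans Set.subset_union_left
      _ ≤ η j := (hKη j).le

theorem lipConst_ball_eq_zero {g : X → ℝ} {x : X} {r : ℝ}
    (hx : x ∉ Metric.thickening r (tsupport g)) : lipConst g (Metric.ball x r) = 0 := by
  have h : ∀ y ∈ Metric.ball x r, g y = 0 := fun y hy =>
    image_eq_zero_of_notMem_tsupport fun hyS =>
      hx (Metric.mem_thickening_iff.2 ⟨y, hyS, by rwa [dist_comm]⟩)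
  refine le_antisymm (lipConst_le_iff.2 fun y hy z hz => ?_) (zero_le)
  simp [h y hy, h z hz]

/-- Dominated convergence: for radii at most `1` the integrand is at most `L ^ q` and vanishes off
the unit thickening of the support. -/
theorem exists_lintegral_lipConst_ball_le [MeasurableSpace X] [BorelSpace X] {m : Measure X}
    {g : X → ℝ} {L : NNReal} (hg : LipschitzWith L g)
    (hm : m (Metric.thickening 1 (tsupport g)) < ∞) {q : ℝ} (hq : 0 < q) {ε : ℝ≥0∞} (hε : ε ≠ 0) :
    ∃ r : ℝ, 0 < r ∧ ∫⁻ x, lipConst g (Metric.ball x r) ^ q ∂m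
      ≤ ∫⁻ x, asymptoticSlope g x ^ q ∂m + ε := by
  set F : X → ℝ≥0∞ := (Metric.thickening 1 (tsupport g)).indicator fun _ => (L : ℝ≥0∞) ^ q with hF
  have hFint : ∫⁻ x, F x ∂m ≠ ∞ := by
    rw [hF, lintegral_indicator_const Metric.isOpen_thickening.measurableSet]
    exact ENNReal.mul_ne_top (ENNReal.rpow_ne_top_of_nonneg hq.le ENNReal.coe_ne_top) hm.ne
  have hle : ∀ x (n : ℕ), lipConst g (Metric.ball x (1 / ((n : ℝ) + 1))) ^ q ≤ F x := by
    intro x n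
    by_cases hx : x ∈ Metric.thickening 1 (tsupport g)
    · rw [hF, Set.indicator_of_mem hx]
      exact ENNReal.rpow_le_rpow (hg.lipConst_le _) hq.le
    · have hn : 1 / ((n : ℝ) + 1) ≤ 1 := by
        rw [div_le_one (by positivity)]
        linarith [Nat.cast_nonneg (α := ℝ) n]
      rw [lipConst_ball_eq_zero fun h => hx (Metric.thickening_mono hn _ h),
        ENNReal.zero_rpow_of_pos hq]
      exact zero_le
  have hlim : Tendsto (fun n : ℕ => ∫⁻ x, lipConst g (Metric.ball x (1 / ((n : ℝ) + 1))) ^ q ∂m)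
      atTop (𝓝 (∫⁻ x, asymptoticSlope g x ^ q ∂m)) := by
    refine tendsto_lintegral_of_dominated_convergence F
      (fun n => (measurable_lipConst_ball g _).pow_const q)
      (fun n => Eventually.of_forall fun x => hle x n) hFint (Eventually.of_forall fun x => ?_)
    exact (ENNReal.continuous_rpow_const.tendsto _).comp (tendsto_lipConst_ball g x)
  have hfin : ∫⁻ x, asymptoticSlope g x ^ q ∂m ≠ ∞ :=
    (le_of_tendsto' hlim fun n => lintegral_mono fun x => hle x n).trans_lt
      (lt_top_iff_ne_top.2 hFint) |>.ne
  obtain ⟨n, hn⟩ := (hlim.eventually_lt_const (ENNReal.lt_add_right hfin hε)).exists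
  exact ⟨1 / ((n : ℝ) + 1), by positivity, hn.le⟩

end Approximation

/-! ### The weight and its integrable majorant. -/

section SlopeWeight

variable {X : Type*} [D : MetricSpace X]

open Classical in
/-- A weight that dominates the oscillation of `g` at the scale `r`, and is at least `j + 1` at the
points of the support of `g` which are not close to `K j`, for `j < N`. -/
noncomputable def slopeWeight (g : X → ℝ) (K : ℕ → Set X) (r : ℝ) (N : ℕ) (y : X) : NNReal :=
  max (lipConst g (Metric.ball y r)).toNNReal ((Finset.range N).sup fun j =>
    if y ∈ tsupport g ∧ ∀ q ∈ K j, 1 / ((j : ℝ) + 1) < dist y q then ((j : NNReal) + 1) else 0)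

/-- An upper bound for `slopeWeight g K r N` near a point, independent of `N`. -/
noncomputable def slopeMajorant (g : X → ℝ) (K : ℕ → Set X) (r : ℝ) (x : X) : ℝ≥0∞ :=
  max (lipConst g (Metric.ball x r)) (⨆ j : ℕ,
    (Metric.thickening 1 (tsupport g) \ K j).indicator (fun _ => (j : ℝ≥0∞) + 1) x)

variable {g : X → ℝ} {K : ℕ → Set X} {L : NNReal}

theorem slopeWeight_le (hg : LipschitzWith L g) (r : ℝ) (N : ℕ) (y : X) :
    slopeWeight g K r N y ≤ max L N := by
  refine max_le_max ?_ (Finset.sup_le fun j hj => ?_)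
  · simpa using ENNReal.toNNReal_mono ENNReal.coe_ne_top (hg.lipConst_le (Metric.ball y r))
  · split_ifs
    · exact_mod_cast Finset.mem_range.1 hj
    · exact zero_le

theorem exists_dist_le_or_le_slopeWeight {r : ℝ} {N j : ℕ} (hj : j < N) {y : X}
    (hy : y ∈ tsupport g) :
    (∃ q ∈ K j, dist y q ≤ 1 / ((j : ℝ) + 1)) ∨ (j : ℝ) + 1 ≤ slopeWeight g K r N y := by
  classical
  refine or_iff_not_imp_left.2 fun h => ?_
  push Not at h
  have h1 := Finset.le_sup (f := fun j : ℕ =>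
    if y ∈ tsupport g ∧ ∀ q ∈ K j, 1 / ((j : ℝ) + 1) < dist y q then ((j : NNReal) + 1) else 0)
    (Finset.mem_range.2 hj)
  simp only [if_pos (And.intro hy h)] at h1
  have h2 : ((j : NNReal) + 1) ≤ slopeWeight g K r N y := by
    refine h1.trans ?_
    rw [slopeWeight]
    convert le_max_right _ _
  exact_mod_cast h2

theorem abs_sub_le_slopeWeight_mul (hg : LipschitzWith L g) {r : ℝ} {N : ℕ} {x y z : X}
    (hy : dist x y < r) (hz : dist x z < r) :
    |g y - g z| ≤ slopeWeight g K r N x * dist y z := by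
  have hfin : lipConst g (Metric.ball x r) ≠ ∞ := ne_top_of_le_ne_top ENNReal.coe_ne_top
    (hg.lipConst_le _)
  have h1 : edist (g y) (g z) ≤ (slopeWeight g K r N x : ℝ≥0∞) * edist y z := by
    refine (lipConst_le_iff.1 (le_refl (lipConst g (Metric.ball x r))) y
      (by rwa [Metric.mem_ball, dist_comm]) z (by rwa [Metric.mem_ball, dist_comm])).trans ?_
    gcongr
    rw [← ENNReal.coe_toNNReal hfin, ENNReal.coe_le_coe]
    exact le_max_left _ _
  rw [edist_dist, edist_dist, ← ENNReal.ofReal_coe_nnreal,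
    ← ENNReal.ofReal_mul (NNReal.coe_nonneg _),
    ENNReal.ofReal_le_ofReal_iff (by positivity)] at h1
  exact h1

/-- If `y` is farther than `1 / (j + 1)` from `K j`, then `x`, closer than that to `y`, is outside
`K j`. The neighbourhood depends on `N` but the bound does not; this matters because `N` is chosen
after `K` and `r`. -/
theorem slopeWeight_le_slopeMajorant (hg : LipschitzWith L g) {r : ℝ} {N : ℕ} {x y : X}
    (hr : dist y x < r) (hN : dist y x < 1 / ((N : ℝ) + 1)) :
    (slopeWeight g K r N y : ℝ≥0∞) ≤ slopeMajorant g K (2 * r) x := by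
  have hfin : lipConst g (Metric.ball y r) ≠ ∞ := ne_top_of_le_ne_top ENNReal.coe_ne_top
    (hg.lipConst_le _)
  rw [slopeWeight, ENNReal.coe_max]
  refine max_le_max ?_ ?_
  · rw [ENNReal.coe_toNNReal hfin]
    exact lipConst_mono (Metric.ball_subset_ball' (by linarith))
  · rw [ENNReal.coe_finset_sup]
    refine Finset.sup_le fun j hj => ?_
    have hjN : 1 / ((N : ℝ) + 1) ≤ 1 / ((j : ℝ) + 1) := by
      have : (j : ℝ) ≤ N := by exact_mod_cast (Finset.mem_range.1 hj).le
      gcongr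
    have hj1 : 1 / ((j : ℝ) + 1) ≤ 1 := by
      rw [div_le_one (by positivity)]
      linarith [Nat.cast_nonneg (α := ℝ) j]
    split_ifs with h
    · have hx : x ∈ Metric.thickening 1 (tsupport g) \ K j := by
        refine ⟨Metric.mem_thickening_iff.2 ⟨y, h.1, ?_⟩, fun hxK => ?_⟩
        · rw [dist_comm]
          linarith
        · linarith [h.2 x hxK]
      refine le_trans ?_ (le_iSup _ j)
      rw [Set.indicator_of_mem hx]
      push_cast
      rfl
    · simp

theorem lintegral_slopeMajorant_le [MeasurableSpace X] [BorelSpace X] {m : Measure X}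
    (hK : ∀ j, IsClosed (K j)) {q : ℝ} (hq : 0 < q) (r : ℝ) :
    ∫⁻ x, slopeMajorant g K r x ^ q ∂m ≤ ∫⁻ x, lipConst g (Metric.ball x r) ^ q ∂m
      + ∑' j : ℕ, ((j : ℝ≥0∞) + 1) ^ q * m (Metric.thickening 1 (tsupport g) \ K j) := by
  have hmeas : ∀ j, MeasurableSet (Metric.thickening 1 (tsupport g) \ K j) := fun j =>
    Metric.isOpen_thickening.measurableSet.diff (hK j).measurableSet
  calc ∫⁻ x, slopeMajorant g K r x ^ q ∂m
      ≤ ∫⁻ x, (lipConst g (Metric.ball x r) ^ q + ∑' j : ℕ,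
        (Metric.thickening 1 (tsupport g) \ K j).indicator
          (fun _ => ((j : ℝ≥0∞) + 1) ^ q) x) ∂m := by
        gcongr with x
        rw [← ENNReal.le_rpow_inv_iff hq]
        refine max_le ?_ (iSup_le fun j => ?_)
        · rw [ENNReal.le_rpow_inv_iff hq]
          exact le_self_add
        · rw [ENNReal.le_rpow_inv_iff hq]
          refine le_add_of_le_right (le_trans ?_ (ENNReal.le_tsum j))
          by_cases hx : x ∈ Metric.thickening 1 (tsupport g) \ K j
          · rw [Set.indicator_of_mem hx, Set.indicator_of_mem hx]
          · rw [Set.indicator_of_notMem hx, ENNReal.zero_rpow_of_pos hq]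
            exact zero_le
    _ = _ := by
        rw [lintegral_add_left ((measurable_lipConst_ball g r).pow_const q), lintegral_tsum
          fun j => (measurable_const.indicator (hmeas j)).aemeasurable]
        simp_rw [lintegral_indicator_const (hmeas _)]

end SlopeWeight

/-! ### Recovery sequences. -/

section Recovery

variable {X : Type*} [MeasurableSpace X]

/-- Approximation of a `D`-Lipschitz function by `d i`-Lipschitz functions. -/
theorem exists_lipschitz_approx (d : ℕ → MetricSpace X) [D : MetricSpace X] [CompleteSpace X]
    [TopologicalSpace.SeparableSpace X] [BorelSpace X] {m : Measure X}
    (hcomplete : @CompleteSpace X (d 0).toUniformSpace)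
    (hmono : ∀ x y : X, Monotone fun i => (d i).dist x y)
    (hlim : ∀ x y : X, Tendsto (fun i => (d i).dist x y) atTop (𝓝 (D.dist x y)))
    (htop : ∀ i, (d i).toUniformSpace.toTopologicalSpace = D.toUniformSpace.toTopologicalSpace)
    {p : ℝ≥0∞} (hp1 : 1 ≤ p) (hp : p ≠ ∞) {g : X → ℝ} {L : NNReal} (hg : LipschitzWith L g)
    (hb : Bornology.IsBounded (tsupport g)) (hm : m (Metric.thickening 1 (tsupport g)) < ∞)
    {ε : ℝ≥0∞} (hε : ε ≠ 0) :
    ∃ N, ∀ i ≥ N, ∃ f : X → ℝ,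
      (∃ K, @LipschitzWith X ℝ (d i).toPseudoMetricSpace.toPseudoEMetricSpace _ K f) ∧
      Continuous f ∧ Function.support f ⊆ tsupport g ∧
      eLpNorm (fun x => f x - g x) p m ≤ ε ∧
      ∫⁻ x, @asymptoticSlope X (d i) f x ^ p.toReal ∂m
        ≤ ∫⁻ x, asymptoticSlope g x ^ p.toReal ∂m + ε := by
  have hp0 : p ≠ 0 := (zero_lt_one.trans_le hp1).ne'
  have hq : 0 < p.toReal := ENNReal.toReal_pos hp0 hp
  set q := p.toReal with hqdef
  set B := Metric.thickening 1 (tsupport g) with hBdef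
  have hSB : tsupport g ⊆ B := Metric.self_subset_thickening one_pos _
  have hε2 : ε / 2 ≠ 0 := by simpa using hε
  obtain ⟨M, hM⟩ := hg.exists_norm_le_of_isBounded_tsupport hb
  -- `c` will bound the error on `K 0`, `c' ^ q` the measure of `B \ K 0`, and `w` the energy of the
  -- extra weight.
  obtain ⟨c, hc0, hc⟩ := ENNReal.exists_nnreal_pos_mul_lt
    (ENNReal.rpow_ne_top_of_nonneg (by positivity : 0 ≤ 1 / q) hm.ne) hε2
  obtain ⟨c', hc'0, hc'⟩ := ENNReal.exists_nnreal_pos_mul_lt (ENNReal.coe_ne_top (r := M)) hε2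
  obtain ⟨w, hw0, hw⟩ := ENNReal.exists_pos_sum_of_countable' hε2 ℕ
  have hj0 : ∀ j : ℕ, ((j : ℝ≥0∞) + 1) ^ q ≠ 0 := fun j => by
    simp [ENNReal.rpow_eq_zero_iff, hq.not_gt]
  have hjtop : ∀ j : ℕ, ((j : ℝ≥0∞) + 1) ^ q ≠ ∞ := fun j =>
    ENNReal.rpow_ne_top_of_nonneg hq.le (by simp)
  obtain ⟨K, hK, hK0, hKη⟩ := exists_isCompact_measure_diff_le m hm
    (η := fun j => min ((c' : ℝ≥0∞) ^ q) (w j / ((j : ℝ≥0∞) + 1) ^ q))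
    fun j => lt_min (ENNReal.rpow_pos (by simpa using hc'0) ENNReal.coe_ne_top)
      (ENNReal.div_pos (hw0 j).ne' (hjtop j))
  obtain ⟨r', hr'0, hr'⟩ := exists_lintegral_lipConst_ball_le hg hm hq hε2
  -- The ball of radius `r` about a point near `x` lies in the ball of radius `2 * r` about `x`.
  obtain ⟨r, rfl⟩ : ∃ r, r' = 2 * r := ⟨r' / 2, by ring⟩
  have hr : 0 < r := by linarith
  set e : ℝ := c / 2 with hedef
  have he : 0 < e := half_pos hc0
  -- With `s, κ ≤ t` this gives `t + s + κ < r` and `L * (t + κ) ≤ e / 2`; the choice of `κ` bounds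
  -- `κ / t * M` by the other half.
  obtain ⟨t, ht, htr, htL⟩ : ∃ t : ℝ, 0 < t ∧ 4 * t ≤ r ∧ 4 * (L * t) ≤ e := by
    refine ⟨min (r / 4) (e / (4 * (L + 1))), by positivity, ?_, ?_⟩
    · linarith [min_le_left (r / 4) (e / (4 * ((L : ℝ) + 1)))]
    · calc 4 * (L * min (r / 4) (e / (4 * ((L : ℝ) + 1))))
          ≤ 4 * ((L + 1) * (e / (4 * ((L : ℝ) + 1)))) := by
            gcongr
            · linarith
            · exact min_le_right _ _
        _ = e := by field_simp
  obtain ⟨κ, hκ, hκt, hκM⟩ : ∃ κ : ℝ, 0 < κ ∧ κ ≤ t ∧ 2 * (κ / t * M) ≤ e := by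
    refine ⟨min t (e * t / (2 * (M + 1))), by positivity, min_le_left _ _, ?_⟩
    calc 2 * (min t (e * t / (2 * ((M : ℝ) + 1))) / t * M)
        ≤ 2 * ((e * t / (2 * ((M : ℝ) + 1))) / t * (M + 1)) := by
          gcongr
          · exact min_le_right _ _
          · linarith
      _ = e := by field_simp
  have hblim : Tendsto (fun j : ℕ => ((M : ℝ) + 2) / ((j : ℝ) + 1)) atTop (𝓝 0) := by
    simpa [div_eq_mul_inv] using
      (tendsto_one_div_add_atTop_nhds_zero_nat (𝕜 := ℝ)).const_mul ((M : ℝ) + 2)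
  obtain ⟨N, hN⟩ := exists_forall_dist_le_add d hcomplete hmono hlim htop hK hblim hκ
  refine ⟨N, fun i hi => ?_⟩
  have hle : ∀ x y : X, (d i).dist x y ≤ D.dist x y := fun x y =>
    (hmono x y).ge_of_tendsto (hlim x y) i
  obtain ⟨s, hs0, hst, hsN⟩ : ∃ s : NNReal, 0 < s ∧ (s : ℝ) ≤ t ∧ (s : ℝ) ≤ 1 / ((N : ℝ) + 1) :=
    ⟨⟨min t (1 / ((N : ℝ) + 1)), by positivity⟩,
      (by positivity : (0 : ℝ) < min t (1 / ((N : ℝ) + 1))), min_le_left _ _, min_le_right _ _⟩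
  have hsN' : ∀ j < N, (s : ℝ) ≤ 1 / ((j : ℝ) + 1) := fun j hj => hsN.trans <| by
    have : (j : ℝ) ≤ N := by exact_mod_cast hj.le
    gcongr
  set W := slopeWeight g K r N with hWdef
  have hcont : @Continuous X ℝ (d i).toUniformSpace.toTopologicalSpace _ g := by
    rw [htop i]
    exact hg.continuous
  have hLip := @lipschitzWith_truncatedDiscreteInf X (d i) g W M (max L N) hM
    (fun x => slopeWeight_le hg r N x) s hs0 e
  -- Used for the positive and negative parts of `g`, which oscillate no more than `g` and so share
  -- its weight.
  have hlower : ∀ g' : X → ℝ, (∀ x, 0 ≤ g' x) → (∀ x, g' x ≤ M) →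
      (∀ y z, |g' y - g' z| ≤ |g y - g z|) → (∀ x, g x = 0 → g' x = 0) →
      ∀ x ∈ K 0, g' x - e ≤ @discreteInf X (d i) g' W s x := by
    intro g' h0 h1 h2 h3 x hx
    have := @sub_le_discreteInf X (d i) g' W s D.dist L r t κ M ht hκ.le (by linarith)
      (fun y z => (h2 y z).trans (hg.dist_le_mul y z))
      (fun x y z hy hz => (h2 y z).trans (abs_sub_le_slopeWeight_mul hg hy hz)) h0 h1
      (tsupport g) (fun x hx => h3 x (image_eq_zero_of_notMem_tsupport hx)) N K hsN'
      (fun j hj y hy => (exists_dist_le_or_le_slopeWeight hj hy).imp_left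
        fun ⟨q, hq, hd⟩ => ⟨q, hq, (hle y q).trans hd⟩)
      (hN i hi) x (fun j _ => hK0 j hx)
    have h4 : L * (t + κ) ≤ 2 * (L * t) := by
      have : (L : ℝ) * κ ≤ L * t := by gcongr
      linarith
    linarith
  have habs : ∀ x, |g x| ≤ M := hM
  set f := @truncatedDiscreteInf X (d i) g W s e with hf
  have hcontf : Continuous f := by
    have := @LipschitzWith.continuous X ℝ (d i).toPseudoMetricSpace.toPseudoEMetricSpace _ _ _ hLip
    rwa [htop i] at this
  have hfg : ∀ x, |f x - g x| ≤ |g x| := fun x =>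
    @abs_truncatedDiscreteInf_sub_le X (d i) g W s e he.le x
  have hfgK : ∀ x ∈ K 0, |f x - g x| ≤ c := by
    intro x hx
    have := @abs_truncatedDiscreteInf_sub_le_of_le X (d i) g W s e he.le x
      (hlower _ (max_zero_nonneg g) (fun x => max_le ((le_abs_self _).trans (habs x)) M.2)
        (fun y z => abs_max_sub_max_le_abs _ _ _) (fun x hx => by simp [hx]) x hx)
      (hlower _ (max_zero_nonneg fun y => -g y)
        (fun x => max_le ((neg_le_abs _).trans (habs x)) M.2)
        (fun y z => (abs_max_sub_max_le_abs _ _ _).trans (by rw [neg_sub_neg, abs_sub_comm]))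
        (fun x hx => by simp [hx]) x hx)
    linarith
  have hf0 : ∀ x, g x = 0 → f x = 0 := fun x hx => by
    have := hfg x
    rw [hx, sub_zero, abs_zero] at this
    exact abs_eq_zero.1 (le_antisymm this (abs_nonneg _))
  refine ⟨f, ⟨_, hLip⟩, hcontf, fun x hx => subset_tsupport g fun h => hx (hf0 x h), ?_, ?_⟩
  · have hBm : MeasurableSet B := Metric.isOpen_thickening.measurableSet
    have hBK : MeasurableSet (B \ K 0) := hBm.diff (hK 0).isClosed.measurableSet
    calc eLpNorm (fun x => f x - g x) p m
        ≤ eLpNorm ((B.indicator fun _ => (c : ℝ)) + (B \ K 0).indicator fun _ => (M : ℝ)) p m := by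
          refine eLpNorm_mono_real fun x => ?_
          rw [Pi.add_apply, Real.norm_eq_abs]
          have h1 : 0 ≤ B.indicator (fun _ => (c : ℝ)) x := Set.indicator_nonneg (fun _ _ => c.2) x
          have h2 : 0 ≤ (B \ K 0).indicator (fun _ => (M : ℝ)) x :=
            Set.indicator_nonneg (fun _ _ => M.2) x
          by_cases hxB : x ∈ B
          · by_cases hxK : x ∈ K 0
            · rw [Set.indicator_of_mem hxB]
              linarith [hfgK x hxK]
            · rw [Set.indicator_of_mem (show x ∈ B \ K 0 from ⟨hxB, hxK⟩)]
              linarith [hfg x, habs x]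
          · have hx0 := image_eq_zero_of_notMem_tsupport fun h => hxB (hSB h)
            have := hfg x
            rw [hx0, abs_zero] at this
            rw [hx0]
            linarith
      _ ≤ eLpNorm (B.indicator fun _ => (c : ℝ)) p m
          + eLpNorm ((B \ K 0).indicator fun _ => (M : ℝ)) p m :=
          eLpNorm_add_le (aestronglyMeasurable_const.indicator hBm)
            (aestronglyMeasurable_const.indicator hBK) hp1
      _ ≤ ‖(c : ℝ)‖ₑ * m B ^ (1 / q) + ‖(M : ℝ)‖ₑ * m (B \ K 0) ^ (1 / q) :=
          add_le_add (eLpNorm_indicator_const_le _ _) (eLpNorm_indicator_const_le _ _)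
      _ ≤ c * m B ^ (1 / q) + M * c' := by
          have h1 : ∀ a : NNReal, ‖(a : ℝ)‖ₑ = a := fun a => by simp [enorm_eq_nnnorm]
          rw [h1, h1]
          gcongr
          rw [one_div, ENNReal.rpow_inv_le_iff hq]
          exact (hKη 0).trans (min_le_left _ _)
      _ ≤ ε / 2 + ε / 2 := by
          rw [mul_comm (M : ℝ≥0∞)]
          gcongr
      _ = ε := ENNReal.add_halves ε
  · have hslope : ∀ x, @asymptoticSlope X (d i) f x ≤ slopeMajorant g K (2 * r) x := by
      intro x
      by_cases htopx : slopeMajorant g K (2 * r) x = ∞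
      · rw [htopx]
        exact le_top
      have hev : ∀ᶠ y in 𝓝 x, W y ≤ (slopeMajorant g K (2 * r) x).toNNReal := by
        filter_upwards [Metric.ball_mem_nhds x hr,
          Metric.ball_mem_nhds x (by positivity : 0 < 1 / ((N : ℝ) + 1))] with y hy1 hy2
        rw [← ENNReal.coe_le_coe, ENNReal.coe_toNNReal htopx]
        exact slopeWeight_le_slopeMajorant hg hy1 hy2
      rw [← htop i] at hev
      have := @asymptoticSlope_truncatedDiscreteInf_le X (d i) g W s hcont hs0 e he x _ hev
      rwa [ENNReal.coe_toNNReal htopx] at this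
    calc ∫⁻ x, @asymptoticSlope X (d i) f x ^ q ∂m
        ≤ ∫⁻ x, slopeMajorant g K (2 * r) x ^ q ∂m :=
          lintegral_mono fun x => ENNReal.rpow_le_rpow (hslope x) hq.le
      _ ≤ _ := lintegral_slopeMajorant_le (fun j => (hK j).isClosed) hq _
      _ ≤ (∫⁻ x, asymptoticSlope g x ^ q ∂m + ε / 2) + ε / 2 := by
          gcongr
          refine (ENNReal.tsum_le_tsum fun j => ?_).trans hw.le
          rw [mul_comm, ← ENNReal.le_div_iff_mul_le (Or.inl (hj0 j)) (Or.inl (hjtop j))]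
          exact (hKη j).trans (min_le_right _ _)
      _ = _ := by rw [add_assoc, ENNReal.add_halves]

end Recovery

theorem isBounded_of_dist_le {X : Type*} (D' : MetricSpace X) [D : MetricSpace X]
    (hle : ∀ x y : X, D'.dist x y ≤ D.dist x y) {S : Set X} (hS : Bornology.IsBounded S) :
    @Bornology.IsBounded X D'.toBornology S := by
  obtain ⟨C, hC⟩ := Metric.isBounded_iff.1 hS
  exact (@Metric.isBounded_iff X D'.toPseudoMetricSpace S).2
    ⟨C, fun x hx y hy => (hle x y).trans (hC hx hy)⟩

/-- Strong approximability of the Cheeger energy along monotone sequences of distances. -/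
theorem exists_forall_cheegerEnergy_le {X : Type*} [MeasurableSpace X] (d : ℕ → MetricSpace X)
    [D : MetricSpace X] [CompleteSpace X]
    [TopologicalSpace.SeparableSpace X] [BorelSpace X] {m : Measure X}
    (hm : ∀ s : Set X, Bornology.IsBounded s → m s < ∞)
    (hcomplete : @CompleteSpace X (d 0).toUniformSpace)
    (hmono : ∀ x y : X, Monotone fun i => (d i).dist x y)
    (hlim : ∀ x y : X, Tendsto (fun i => (d i).dist x y) atTop (𝓝 (D.dist x y)))
    (htop : ∀ i, (d i).toUniformSpace.toTopologicalSpace = D.toUniformSpace.toTopologicalSpace)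
    {p : ℝ≥0∞} [Fact (1 ≤ p)] (hp : p ≠ ∞) (f : Lp ℝ p m) {ε : ℝ≥0∞} (hε : ε ≠ 0) {δ : ℝ}
    (hδ : 0 < δ) :
    ∃ N, ∀ i ≥ N, ∃ h : Lp ℝ p m, dist h f ≤ δ ∧
      cheegerEnergy (d i) m p h ≤ cheegerEnergy D m p f + ε := by
  by_cases hfin : cheegerEnergy D m p f = ∞
  · exact ⟨0, fun i _ => ⟨f, by simpa using hδ.le, by simp [hfin]⟩⟩
  have hp1 : 1 ≤ p := Fact.out
  have hq1 : 1 ≤ p.toReal := by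
    rw [← ENNReal.toReal_one]
    exact ENNReal.toReal_mono hp hp1
  have hε4 : ε / 2 / 2 ≠ 0 := by simpa using hε
  have hε2 : ε / 2 ≠ 0 := by simpa using hε
  obtain ⟨h₀, hh₀, hE⟩ := (cheegerEnergy_le_iff D (f := f)).1 le_rfl (min 1 (ε / 2 / 2))
    (by simp [hε]) (δ / 2) (half_pos hδ)
  have hlt : asymptoticEnergy D m p h₀ < cheegerEnergy D m p f + ε / 2 := by
    have hne : cheegerEnergy D m p f + min 1 (ε / 2 / 2) ≠ ∞ :=
      ENNReal.add_ne_top.2 ⟨hfin, ((min_le_left _ _).trans_lt ENNReal.one_lt_top).ne⟩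
    refine hE.trans_lt ((ENNReal.lt_add_right hne hε4).trans_le ?_)
    rw [add_assoc]
    gcongr
    exact (add_le_add_left (min_le_right _ _) _).trans (ENNReal.add_halves _).le
  obtain ⟨g, ⟨⟨L, hg⟩, hb, hae⟩, hgE⟩ := (asymptoticEnergy_lt_iff D).1 hlt
  obtain ⟨N, hN⟩ := exists_lipschitz_approx d hcomplete hmono hlim htop hp1 hp hg hb
    (hm _ hb.thickening) (ε := min (ε / 2) (ENNReal.ofReal (δ / 2))) (by simp [hε, hδ])
  refine ⟨N, fun i hi => ?_⟩
  obtain ⟨u, ⟨K, hK⟩, hcont, hsupp, hnorm, hslope⟩ := hN i hi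
  have hle : ∀ x y : X, (d i).dist x y ≤ D.dist x y := fun x y =>
    (hmono x y).ge_of_tendsto (hlim x y) i
  have hgm : MemLp g p m := (memLp_congr_ae hae).1 (Lp.memLp h₀)
  have hum : MemLp u p m := by
    have hdiff : MemLp (fun x => u x - g x) p m := by
      refine ⟨(hcont.sub hg.continuous).aestronglyMeasurable, hnorm.trans_lt ?_⟩
      exact (min_le_right _ _).trans_lt ENNReal.ofReal_lt_top
    convert hdiff.add hgm using 1
    ext x
    simp
  refine ⟨hum.toLp, ?_, ?_⟩
  · have h1 : dist (hum.toLp : Lp ℝ p m) h₀ ≤ δ / 2 := by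
      rw [Lp.dist_def]
      refine ENNReal.toReal_le_of_le_ofReal (half_pos hδ).le ?_
      refine le_trans (le_of_eq (eLpNorm_congr_ae ?_)) (hnorm.trans (min_le_right _ _))
      filter_upwards [hum.coeFn_toLp, hae] with x hx1 hx2
      simp [hx1, hx2]
    linarith [dist_triangle (hum.toLp : Lp ℝ p m) h₀ f]
  · have hbdd : @Bornology.IsBounded X (d i).toBornology
        (@tsupport X ℝ _ (d i).toUniformSpace.toTopologicalSpace u) := by
      refine isBounded_of_dist_le (d i) hle (hb.subset ?_)
      rw [htop i]
      exact closure_minimal hsupp (isClosed_tsupport g)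
    refine (cheegerEnergy_le_asymptoticEnergy (d i) _).trans ?_
    refine (iInf₂_le u ⟨⟨K, hK⟩, hbdd, hum.coeFn_toLp⟩).trans ?_
    -- The factor `1 / p` does not enlarge the error in the slope integral.
    have hinv : ENNReal.ofReal (1 / p.toReal) ≤ 1 := by
      rw [ENNReal.ofReal_le_one, div_le_one (by linarith)]
      exact hq1
    calc ENNReal.ofReal (1 / p.toReal) * ∫⁻ x, @asymptoticSlope X (d i) u x ^ p.toReal ∂m
        ≤ ENNReal.ofReal (1 / p.toReal)
            * (∫⁻ x, asymptoticSlope g x ^ p.toReal ∂m + ε / 2) := by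
          gcongr
          exact hslope.trans (add_le_add_right (min_le_left _ _) _)
      _ ≤ (cheegerEnergy D m p f + ε / 2) + ε / 2 := by
          rw [mul_add]
          exact add_le_add hgE.le (mul_le_of_le_one_left' hinv)
      _ = _ := by rw [add_assoc, ENNReal.add_halves]

/-! ### Diagonal extraction and conclusion. -/

theorem exists_seq_of_forall_eventually {E : Type*} {P : ℕ → ℕ → E → Prop} [Nonempty E]
    (h : ∀ k, ∃ N, ∀ i ≥ N, ∃ x, P k i x) :
    ∃ (u : ℕ → E) (κ : ℕ → ℕ), Tendsto κ atTop atTop ∧ ∀ᶠ i in atTop, P (κ i) i (u i) := by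
  classical
  choose N hN using h
  -- The best accuracy available at stage `i`. The default value `0` is legitimate once `i ≥ N 0`.
  let κ : ℕ → ℕ := fun i => Nat.findGreatest (fun k => N k ≤ i) i
  have hκ : ∀ i, ∃ x, N (κ i) ≤ i → P (κ i) i x := fun i => by
    by_cases hi : N (κ i) ≤ i
    · exact (hN _ i hi).imp fun _ hx _ => hx
    · exact ⟨Classical.arbitrary E, fun hi' => absurd hi' hi⟩
  choose u hu using hκ
  refine ⟨u, κ, tendsto_atTop.2 fun k => ?_, ?_⟩
  · filter_upwards [eventually_ge_atTop (max k (N k))] with i hi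
    exact Nat.le_findGreatest ((le_max_left _ _).trans hi) ((le_max_right _ _).trans hi)
  · filter_upwards [eventually_ge_atTop (N 0)] with i hi
    exact hu i (Nat.findGreatest_spec (P := fun k => N k ≤ i) (Nat.zero_le i) hi)

theorem theorem4p1 {X : Type*} [D : MetricSpace X] [CompleteSpace X]
    [TopologicalSpace.SeparableSpace X] [MeasurableSpace X] [BorelSpace X]
    (m : Measure X) (hm : ∀ s : Set X, Bornology.IsBounded s → m s < ∞)
    (d : ℕ → MetricSpace X)
    (hcomplete : ∀ i, @CompleteSpace X (d i).toUniformSpace)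
    (hmono : ∀ x y : X, Monotone fun i => (d i).dist x y)
    (hlim : ∀ x y : X, Tendsto (fun i => (d i).dist x y) atTop (𝓝 (D.dist x y)))
    (htop : ∀ i, (d i).toUniformSpace.toTopologicalSpace = D.toUniformSpace.toTopologicalSpace)
    (p : ℝ≥0∞) [Fact (1 ≤ p)] (hp1 : 1 < p) (hp2 : p < ∞) :
    MoscoConverges (fun i => cheegerEnergy (d i) m p) (cheegerEnergy D m p) := by
  have hle : ∀ i x y, (d i).dist x y ≤ D.dist x y := fun i x y =>
    (hmono x y).ge_of_tendsto (hlim x y) i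
  refine ⟨fun f u hu => ?_, fun f => ?_⟩
  · refine (cheegerEnergy_le_liminf_of_weaklyConverges D hp2.ne hu).trans
      (liminf_le_liminf (Eventually.of_forall fun i => ?_))
    -- The cutoffs need a base point.
    rcases isEmpty_or_nonempty X with hX | hX
    · have : d i = D := MetricSpace.ext (by ext x; exact hX.elim x)
      exact this ▸ le_rfl
    · exact cheegerEnergy_le_of_dist_le (d i) D (hle i) hp2.ne (u i)
  · obtain ⟨u, κ, hκ, hu⟩ := exists_seq_of_forall_eventually (E := Lp ℝ p m)
      fun k : ℕ => exists_forall_cheegerEnergy_le d hm (hcomplete 0) hmono hlim htop hp2.ne f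
        (ε := ((k : ℝ≥0∞) + 1)⁻¹) (by simp) (δ := 1 / ((k : ℝ) + 1)) (by positivity)
    refine ⟨u, ?_, ?_⟩
    · rw [tendsto_iff_dist_tendsto_zero]
      exact squeeze_zero' (Eventually.of_forall fun _ => dist_nonneg) (hu.mono fun i hi => hi.1)
        (tendsto_one_div_add_atTop_nhds_zero_nat.comp hκ)
    · exact (limsup_le_limsup (hu.mono fun i hi => hi.2)).trans
        ((tendsto_add_inv_natCast_add_one _).comp hκ).limsup_eq.le
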